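/- Let $\mathfrak t$ be a finite-dimensional real inner product space with Lebesgue measure, let $e_1,\dots,e_n$ be an orthonormal basis of $\mathfrak t$ with dual basis $\varepsilon^1,\dots,\varepsilon^n$ of $\mathfrak t^*$, and let $y^j=\varepsilon^j(y)$ be the corresponding coordinates. Let $\mathcal{C}\ell(\mathfrak t\times\mathfrak t^*)$ be the complex $\mathbb Z/2$-graded Clifford $*$-algebra of $\mathfrak t\times\mathfrak t^*$, in which each of the $2n$ anticommuting generators $e_j,\varepsilon^j$ satisfies $c^2=-1$ and $c^*=-c$. Let $P=\prod_j\tfrac12(1-i\,e_j\varepsilon^j)$, a projection with $P\,\mathcal{C}\ell(\mathfrak t\times\mathfrak t^*)P=\mathbb CP\cong\mathbb C$, and let $\mathcal S=\mathcal{C}\ell(\mathfrak t\times\mathfrak t^*)P$, a finite-dimensional Hilbert space with inner product $\langle aP,bP\rangle=Pa^*bP\in\mathbb CP\cong\mathbb C$, on which the Clifford algebra acts by left multiplication, and which is graded by the grading of the Clifford algebra. Grade $L^2(\mathfrak t)\otimes\mathcal S=L^2(\mathfrak t;\mathcal S)$ by the grading of $\mathcal S$. Let $Q_0$ be the unbounded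 operator on $L^2(\mathfrak t)\otimes\mathcal S$ obtained as the closure of $$f\longmapsto\sum_{j=1}^n\Big(\varepsilon^j\,\frac{\partial f}{\partial y^j}-2\pi i\,y^j\,e_j f\Big)$$ on the $\mathcal S$-valued Schwartz functions, i.e. $Q_0(v\otimes a)=\sum_j\big(\frac{\partial v}{\partial y^j}\otimes\varepsilon^ja-2\pi i\,y^jv\otimes e_ja\big)$. Then $Q_0$ is self-adjoint and has compact resolvent: $(Q_0-z)^{-1}$ exists as a bounded operator for some $z\in\mathbb C$, and is compact for every $z$ for which it exists. The kernel of $Q_0$ is one-dimensional, consisting exactly of the multiples of $y\mapsto e^{-\pi|y|^2}P$, and it has even grading, that is, it is contained in the even part of $L^2(\mathfrak t)\otimes\mathcal S$. -/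

import Mathlib

namespace Ladder

open scoped TensorProduct

set_option linter.unusedSectionVars false

section Algebra

variable {A : Type*} [Ring A] [Algebra ℂ A] {n : ℕ}

/-- The commuting elements `½ (1 - i e_j ε^j)`. -/
noncomputable def halfProj (E F : Fin n → A) (j : Fin n) : A :=
  (1 / 2 : ℂ) • (1 - Complex.I • (E j * F j))

/-- The product `∏_j ½ (1 - i e_j ε^j)`. -/
noncomputable def vacuumProj (E F : Fin n → A) : A :=
  (List.ofFn (halfProj E F)).prod

/-- The Clifford relations with all generators squaring to `-1`. -/
structure CliffordRel [StarRing A] (E F : Fin n → A) : Prop where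
  E_sq : ∀ j, E j * E j = -1
  F_sq : ∀ j, F j * F j = -1
  EE : ∀ i j, i ≠ j → E i * E j = -(E j * E i)
  FF : ∀ i j, i ≠ j → F i * F j = -(F j * F i)
  EF : ∀ i j, E i * F j = -(F j * E i)
  star_E : ∀ j, star (E j) = -E j
  star_F : ∀ j, star (F j) = -F j

variable [StarRing A] [StarModule ℂ A] {E F : Fin n → A}

theorem CliffordRel.halfProj_mul_self (h : CliffordRel E F) (j : Fin n) :
    halfProj E F j * halfProj E F j = halfProj E F j := by
  have h1 : (E j * F j) * (E j * F j) = -1 := by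
    have : (E j * F j) * (E j * F j) = E j * (F j * E j) * F j := by noncomm_ring
    rw [this, ← neg_eq_iff_eq_neg.mpr (h.EF j j)]
    have : E j * -(E j * F j) * F j = -((E j * E j) * (F j * F j)) := by noncomm_ring
    rw [this, h.E_sq, h.F_sq]; simp
  simp only [halfProj, smul_mul_assoc, mul_smul_comm, mul_sub, sub_mul, h1, mul_one, one_mul,
    smul_sub, smul_smul, smul_neg]
  rw [show (1 / 2 * Complex.I * (1 / 2 * Complex.I) : ℂ) = -(1 / 2 * (1 / 2)) by
    rw [mul_mul_mul_comm, Complex.I_mul_I]; ring]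
  module

theorem CliffordRel.star_halfProj (h : CliffordRel E F) (j : Fin n) :
    star (halfProj E F j) = halfProj E F j := by
  simp only [halfProj, star_smul, star_sub, star_one, star_mul, h.star_E, h.star_F,
    neg_mul_neg]
  rw [← neg_eq_iff_eq_neg.mpr (h.EF j j)]
  simp

theorem CliffordRel.E_mul_EF (h : CliffordRel E F) {i j : Fin n} (hij : i ≠ j) :
    Commute (E i) (E j * F j) := by
  show E i * (E j * F j) = (E j * F j) * E i
  rw [← mul_assoc, h.EE i j hij, mul_assoc, ← neg_eq_iff_eq_neg.mpr (h.EF i j)]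
  noncomm_ring

theorem CliffordRel.F_mul_EF (h : CliffordRel E F) {i j : Fin n} (hij : i ≠ j) :
    Commute (F i) (E j * F j) := by
  show F i * (E j * F j) = (E j * F j) * F i
  rw [← mul_assoc, ← neg_eq_iff_eq_neg.mpr (h.EF j i), mul_assoc, h.FF j i hij.symm]
  noncomm_ring

theorem CliffordRel.E_commute (h : CliffordRel E F) {i j : Fin n} (hij : i ≠ j) :
    Commute (E i) (halfProj E F j) :=
  Commute.smul_right ((Commute.one_right _).sub_right ((h.E_mul_EF hij).smul_right _)) _

theorem CliffordRel.F_commute (h : CliffordRel E F) {i j : Fin n} (hij : i ≠ j) :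
    Commute (F i) (halfProj E F j) :=
  Commute.smul_right ((Commute.one_right _).sub_right ((h.F_mul_EF hij).smul_right _)) _

theorem CliffordRel.halfProj_commute (h : CliffordRel E F) (i j : Fin n) :
    Commute (halfProj E F i) (halfProj E F j) := by
  by_cases hij : i = j
  · rw [hij]
  · exact Commute.smul_left ((Commute.one_left _).sub_left
      (((h.E_commute hij).mul_left (h.F_commute hij)).smul_left _)) _

theorem CliffordRel.halfProj_mul_E (h : CliffordRel E F) (j : Fin n) :
    halfProj E F j * E j = E j * (1 - halfProj E F j) := by
  have h1 : E j * F j * E j = -(E j * (E j * F j)) := by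
    rw [mul_assoc, ← neg_eq_iff_eq_neg.mpr (h.EF j j)]; noncomm_ring
  simp only [halfProj, smul_mul_assoc, mul_smul_comm, mul_sub, sub_mul, h1, mul_one, one_mul,
    smul_sub, smul_smul, smul_neg]
  module

/-- Partial products of the elements `½ (1 - i e_j ε^j)`. -/
noncomputable def partProj (E F : Fin n → A) (l : List (Fin n)) : A :=
  (l.map (halfProj E F)).prod

theorem vacuumProj_eq : vacuumProj E F = partProj E F (List.finRange n) := by
  rw [vacuumProj, partProj, List.ofFn_eq_map]

theorem CliffordRel.halfProj_commute_part (h : CliffordRel E F) (i : Fin n) (l : List (Fin n)) :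
    Commute (halfProj E F i) (partProj E F l) := by
  refine Commute.list_prod_right _ _ fun x hx => ?_
  obtain ⟨j, -, rfl⟩ := List.mem_map.1 hx
  exact h.halfProj_commute i j

theorem CliffordRel.star_part (h : CliffordRel E F) (l : List (Fin n)) :
    star (partProj E F l) = partProj E F l := by
  induction l with
  | nil => simp [partProj]
  | cons a l ih =>
    have : partProj E F (a :: l) = halfProj E F a * partProj E F l := by simp [partProj]
    rw [this, star_mul, ih, h.star_halfProj, (h.halfProj_commute_part a l).eq]

theorem CliffordRel.halfProj_mul_part (h : CliffordRel E F) {j : Fin n} {l : List (Fin n)}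
    (hj : j ∈ l) : halfProj E F j * partProj E F l = partProj E F l := by
  induction l with
  | nil => simp at hj
  | cons a l ih =>
    have : partProj E F (a :: l) = halfProj E F a * partProj E F l := by simp [partProj]
    rw [this]
    by_cases hja : j = a
    · rw [hja, ← mul_assoc, h.halfProj_mul_self]
    · rw [← mul_assoc, (h.halfProj_commute j a).eq, mul_assoc,
        ih (by simpa [hja] using hj)]

theorem CliffordRel.star_vacuum (h : CliffordRel E F) :
    star (vacuumProj E F) = vacuumProj E F := by
  rw [vacuumProj_eq, h.star_part]

theorem CliffordRel.halfProj_mul_vacuum (h : CliffordRel E F) (j : Fin n) :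
    halfProj E F j * vacuumProj E F = vacuumProj E F := by
  rw [vacuumProj_eq, h.halfProj_mul_part (List.mem_finRange j)]

theorem CliffordRel.vacuum_mul_halfProj (h : CliffordRel E F) (j : Fin n) :
    vacuumProj E F * halfProj E F j = vacuumProj E F := by
  have := h.halfProj_mul_vacuum j
  rwa [vacuumProj_eq, (h.halfProj_commute_part _ _).eq, ← vacuumProj_eq] at this

theorem CliffordRel.vacuum_mul_self (h : CliffordRel E F) :
    vacuumProj E F * vacuumProj E F = vacuumProj E F := by
  have key : ∀ l : List (Fin n), partProj E F l * vacuumProj E F = vacuumProj E F := by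
    intro l
    induction l with
    | nil => simp [partProj]
    | cons a l ih =>
      have : partProj E F (a :: l) = halfProj E F a * partProj E F l := by simp [partProj]
      rw [this, mul_assoc, ih, h.halfProj_mul_vacuum]
  nth_rewrite 1 [vacuumProj_eq]
  exact key _

theorem CliffordRel.F_mul_vacuum (h : CliffordRel E F) (j : Fin n) :
    F j * vacuumProj E F = -(Complex.I • (E j * vacuumProj E F)) := by
  have h1 := congrArg (fun x => E j * x) (h.halfProj_mul_vacuum j)
  simp only [halfProj, smul_mul_assoc, sub_mul, one_mul, mul_smul_comm, mul_sub,
    ← mul_assoc, h.E_sq, neg_mul] at h1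
  have h2 : F j * vacuumProj E F =
      -(Complex.I • (E j * vacuumProj E F)) := by
    have h3 : Complex.I • (F j * vacuumProj E F) = E j * vacuumProj E F := by
      have := congrArg (fun x => (2 : ℂ) • x) h1
      simp only [smul_smul, smul_neg, smul_sub] at this
      rw [show (2 * (1 / 2) : ℂ) = 1 by norm_num, one_smul,
        show (2 * (1 / 2 * Complex.I) : ℂ) = Complex.I by ring, two_smul, sub_neg_eq_add] at this
      exact add_left_cancel this
    rw [← h3, smul_smul, Complex.I_mul_I]; simp
  exact h2

/-- Conjugates of the vacuum projection add up to the identity. -/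
theorem CliffordRel.exists_resolution (h : CliffordRel E F) :
    ∃ L : List A, (L.map fun u => u * vacuumProj E F * star u).sum = 1 := by
  have key : ∀ l : List (Fin n), l.Nodup →
      ∃ L : List A, (L.map fun u => u * partProj E F l * star u).sum = 1 := by
    intro l
    induction l with
    | nil => intro _; exact ⟨[1], by simp [partProj]⟩
    | cons a l ih =>
      intro hl
      rw [List.nodup_cons] at hl
      obtain ⟨L, hL⟩ := ih hl.2
      refine ⟨L ++ L.map (· * E a), ?_⟩
      rw [← hL, List.map_append, List.sum_append, List.map_map, ← List.sum_map_add]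
      congr 1
      refine List.map_congr_left fun u _ => ?_
      have hp : partProj E F (a :: l) = halfProj E F a * partProj E F l := by simp [partProj]
      have hc : Commute (E a) (partProj E F l) := by
        refine Commute.list_prod_right _ _ fun x hx => ?_
        obtain ⟨j, hj, rfl⟩ := List.mem_map.1 hx
        exact h.E_commute (fun haj => hl.1 (haj ▸ hj))
      have h2 : E a * halfProj E F a * partProj E F l * E a =
          -((1 - halfProj E F a) * partProj E F l) := by
        rw [mul_assoc _ _ (E a), ← hc.eq, ← mul_assoc, mul_assoc (E a) _ (E a),
          h.halfProj_mul_E, ← mul_assoc, h.E_sq]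
        noncomm_ring
      simp only [Function.comp_apply, hp, star_mul, h.star_E]
      calc u * (halfProj E F a * partProj E F l) * star u +
            u * E a * (halfProj E F a * partProj E F l) * (-E a * star u)
          = u * (halfProj E F a * partProj E F l
              - E a * halfProj E F a * partProj E F l * E a) * star u := by noncomm_ring
        _ = _ := by rw [h2]; noncomm_ring
  rw [vacuumProj_eq]
  exact key _ (List.nodup_finRange n)

theorem CliffordRel.vacuum_ne_zero [Nontrivial A] (h : CliffordRel E F) :
    vacuumProj E F ≠ 0 := by
  intro h0
  obtain ⟨L, hL⟩ := h.exists_resolution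
  simp [h0] at hL

/-- The span of the vectors `e_{j₁} ⋯ e_{jₖ} P`. -/
def wordSpan (E F : Fin n → A) : Submodule ℂ A :=
  Submodule.span ℂ (Set.range fun w : List (Fin n) => (w.map E).prod * vacuumProj E F)

theorem CliffordRel.E_word (h : CliffordRel E F) (j : Fin n) (w : List (Fin n)) :
    ∃ s : ℂ, E j * (w.map E).prod = s • ((w.map E).prod * E j) := by
  induction w with
  | nil => exact ⟨1, by simp⟩
  | cons a w ih =>
    obtain ⟨s, hs⟩ := ih
    by_cases hja : j = a
    · refine ⟨s, ?_⟩
      subst hja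
      rw [List.map_cons, List.prod_cons, hs, mul_smul_comm, ← hs, mul_assoc, ← mul_smul_comm,
        ← hs]
    · refine ⟨-s, ?_⟩
      rw [List.map_cons, List.prod_cons, ← mul_assoc, h.EE j a hja, neg_mul, mul_assoc, hs,
        mul_smul_comm, neg_smul, mul_assoc]

theorem CliffordRel.F_word (h : CliffordRel E F) (j : Fin n) (w : List (Fin n)) :
    ∃ s : ℂ, F j * (w.map E).prod = s • ((w.map E).prod * F j) := by
  induction w with
  | nil => exact ⟨1, by simp⟩
  | cons a w ih =>
    obtain ⟨s, hs⟩ := ih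
    refine ⟨-s, ?_⟩
    rw [List.map_cons, List.prod_cons, ← mul_assoc, ← neg_eq_iff_eq_neg.mpr (h.EF a j), neg_mul,
      mul_assoc, hs, mul_smul_comm, neg_smul, mul_assoc]

theorem CliffordRel.vacuum_word_vacuum (h : CliffordRel E F) :
    ∀ (k : ℕ) (w : List (Fin n)), w.length ≤ k →
      ∃ c : ℂ, vacuumProj E F * ((w.map E).prod * vacuumProj E F) = c • vacuumProj E F := by
  intro k
  induction k with
  | zero =>
    intro w hw
    obtain rfl : w = [] := List.length_eq_zero_iff.1 (by omega)
    exact ⟨1, by simp [h.vacuum_mul_self]⟩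
  | succ k ih =>
    intro w hw
    cases w with
    | nil => exact ⟨1, by simp [h.vacuum_mul_self]⟩
    | cons j w =>
      by_cases hj : j ∈ w
      · obtain ⟨a, b, rfl⟩ := List.append_of_mem hj
        obtain ⟨s, hs⟩ := h.E_word j a
        obtain ⟨c, hc⟩ := ih (a ++ b) (by simp at hw ⊢; omega)
        refine ⟨-s * c, ?_⟩
        have : ((j :: (a ++ j :: b)).map E).prod = (-s) • ((a ++ b).map E).prod := by
          simp only [List.map_cons, List.map_append, List.prod_cons, List.prod_append]
          rw [← mul_assoc, hs, smul_mul_assoc, mul_assoc, ← mul_assoc (E j), h.E_sq]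
          simp
        rw [this, smul_mul_assoc, mul_smul_comm, hc, smul_smul]
      · refine ⟨0, ?_⟩
        have hc : Commute (halfProj E F j) (w.map E).prod := by
          refine Commute.list_prod_right _ _ fun x hx => ?_
          obtain ⟨i, hi, rfl⟩ := List.mem_map.1 hx
          exact (h.E_commute (by rintro rfl; exact hj hi)).symm
        rw [List.map_cons, List.prod_cons, zero_smul]
        calc vacuumProj E F * (E j * (w.map E).prod * vacuumProj E F)
            = vacuumProj E F * (halfProj E F j * E j) * (w.map E).prod * vacuumProj E F := by
              nth_rewrite 1 [← h.vacuum_mul_halfProj j]; noncomm_ring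
          _ = vacuumProj E F * E j * (w.map E).prod * vacuumProj E F
              - vacuumProj E F * E j * (halfProj E F j * (w.map E).prod) * vacuumProj E F := by
              rw [h.halfProj_mul_E]; noncomm_ring
          _ = 0 := by
              rw [hc.eq, sub_eq_zero, mul_assoc (vacuumProj E F * E j) _ (vacuumProj E F),
                mul_assoc (vacuumProj E F * E j) _ (vacuumProj E F),
                mul_assoc _ (halfProj E F j), h.halfProj_mul_vacuum]

theorem CliffordRel.E_mul_mem (_h : CliffordRel E F) (j : Fin n) {x : A}
    (hx : x ∈ wordSpan E F) : E j * x ∈ wordSpan E F := by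
  induction hx using Submodule.span_induction with
  | mem x hx =>
    obtain ⟨w, rfl⟩ := hx
    exact Submodule.subset_span ⟨j :: w, by simp [mul_assoc]⟩
  | zero => simp
  | add x y _ _ hx hy => rw [mul_add]; exact add_mem hx hy
  | smul c x _ hx => rw [mul_smul_comm]; exact Submodule.smul_mem _ _ hx

theorem CliffordRel.F_mul_mem (h : CliffordRel E F) (j : Fin n) {x : A}
    (hx : x ∈ wordSpan E F) : F j * x ∈ wordSpan E F := by
  induction hx using Submodule.span_induction with
  | mem x hx =>
    obtain ⟨w, rfl⟩ := hx
    obtain ⟨s, hs⟩ := h.F_word j w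
    show F j * ((w.map E).prod * vacuumProj E F) ∈ _
    rw [← mul_assoc, hs, smul_mul_assoc, mul_assoc, h.F_mul_vacuum, mul_neg, mul_smul_comm]
    refine Submodule.smul_mem _ _ (neg_mem (Submodule.smul_mem _ _ ?_))
    exact Submodule.subset_span ⟨w ++ [j], by simp [mul_assoc]⟩
  | zero => simp
  | add x y _ _ hx hy => rw [mul_add]; exact add_mem hx hy
  | smul c x _ hx => rw [mul_smul_comm]; exact Submodule.smul_mem _ _ hx

theorem CliffordRel.corner (h : CliffordRel E F)
    (hspan : ∀ x : A, x * vacuumProj E F ∈ wordSpan E F) (x : A) :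
    ∃ c : ℂ, vacuumProj E F * x * vacuumProj E F = c • vacuumProj E F := by
  have key : ∀ y ∈ wordSpan E F, ∃ c : ℂ, vacuumProj E F * y = c • vacuumProj E F := by
    intro y hy
    induction hy using Submodule.span_induction with
    | mem x hx =>
      obtain ⟨w, rfl⟩ := hx
      exact h.vacuum_word_vacuum _ w le_rfl
    | zero => exact ⟨0, by simp⟩
    | add x y _ _ hx hy =>
      obtain ⟨c, hc⟩ := hx
      obtain ⟨d, hd⟩ := hy
      exact ⟨c + d, by rw [mul_add, hc, hd, add_smul]⟩
    | smul a x _ hx =>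
      obtain ⟨c, hc⟩ := hx
      exact ⟨a * c, by rw [mul_smul_comm, hc, smul_smul]⟩
  obtain ⟨c, hc⟩ := key _ (hspan x)
  exact ⟨c, by rw [mul_assoc, hc]⟩

end Algebra

section Clifford

variable (𝔱 : Type*) [NormedAddCommGroup 𝔱] [InnerProductSpace ℝ 𝔱] [FiniteDimensional ℝ 𝔱]

/-- The negative definite form `(v, ξ) ↦ -(‖v‖² + ‖ξ‖²)` on `𝔱 × 𝔱*`. -/
noncomputable def form : QuadraticForm ℝ (𝔱 × StrongDual ℝ 𝔱) :=
  -(QuadraticMap.prod (LinearMap.BilinMap.toQuadraticMap (innerₗ 𝔱))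
    ((LinearMap.BilinMap.toQuadraticMap (innerₗ 𝔱)).comp
      ((InnerProductSpace.toDual ℝ 𝔱).symm.toLinearEquiv.toLinearMap)))

theorem form_apply (v : 𝔱) (ξ : StrongDual ℝ 𝔱) : form 𝔱 (v, ξ) = -(‖v‖ ^ 2 + ‖ξ‖ ^ 2) := by
  rw [← (InnerProductSpace.toDual ℝ 𝔱).symm.norm_map ξ]
  simp [form]

noncomputable instance : StarModule ℝ (CliffordAlgebra (form 𝔱)) where
  star_smul r x := by rw [CliffordAlgebra.star_smul]; simp

/-- The complex Clifford algebra `Cℓ(𝔱 × 𝔱*)`; its adjoint operation is conjugate linear with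
`c* = -c` for every generator `c`. -/
abbrev Cl : Type _ := ℂ ⊗[ℝ] CliffordAlgebra (form 𝔱)


theorem starModule_cl_smul (c : ℂ) (x : Cl 𝔱) : star (c • x) = star c • star x := by
  induction x using TensorProduct.induction_on with
  | zero => simp
  | tmul z y => simp [TensorProduct.smul_tmul']
  | add x y hx hy => simp [hx, hy, smul_add]

noncomputable instance : StarModule ℂ (Cl 𝔱) := ⟨starModule_cl_smul 𝔱⟩

variable {𝔱} {n : ℕ} (b : OrthonormalBasis (Fin n) ℝ 𝔱)

/-- The dual basis covector `ε^j`, that is `y ↦ y^j = ⟪e_j, y⟫`. -/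
noncomputable def dualVec (j : Fin n) : StrongDual ℝ 𝔱 := innerSL ℝ (b j)

/-- The generator `e_j` of `Cℓ(𝔱 × 𝔱*)`. -/
noncomputable def genE (j : Fin n) : Cl 𝔱 :=
  1 ⊗ₜ[ℝ] CliffordAlgebra.ι (form 𝔱) (b j, 0)

/-- The generator `ε^j` of `Cℓ(𝔱 × 𝔱*)`. -/
noncomputable def genF (j : Fin n) : Cl 𝔱 :=
  1 ⊗ₜ[ℝ] CliffordAlgebra.ι (form 𝔱) (0, dualVec b j)

theorem ι_sq (m : 𝔱 × StrongDual ℝ 𝔱) :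
    (1 ⊗ₜ[ℝ] CliffordAlgebra.ι (form 𝔱) m : Cl 𝔱) * (1 ⊗ₜ[ℝ] CliffordAlgebra.ι (form 𝔱) m)
      = algebraMap ℝ (Cl 𝔱) (form 𝔱 m) := by
  rw [Algebra.TensorProduct.tmul_mul_tmul, CliffordAlgebra.ι_sq_scalar, mul_one,
    Algebra.algebraMap_eq_smul_one, TensorProduct.tmul_smul, Algebra.algebraMap_eq_smul_one]
  rfl

theorem ι_anticomm (m m' : 𝔱 × StrongDual ℝ 𝔱)
    (h : form 𝔱 (m + m') = form 𝔱 m + form 𝔱 m') :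
    (1 ⊗ₜ[ℝ] CliffordAlgebra.ι (form 𝔱) m : Cl 𝔱) * (1 ⊗ₜ[ℝ] CliffordAlgebra.ι (form 𝔱) m')
      = -((1 ⊗ₜ[ℝ] CliffordAlgebra.ι (form 𝔱) m') * (1 ⊗ₜ[ℝ] CliffordAlgebra.ι (form 𝔱) m)) := by
  have h1 := ι_sq (m + m')
  rw [map_add, TensorProduct.tmul_add, add_mul, mul_add, mul_add, ι_sq, ι_sq, h, map_add] at h1
  rw [eq_neg_iff_add_eq_zero]
  have h2 := sub_eq_zero.2 h1
  rw [← h2]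
  abel

theorem form_basis (i j : Fin n) (hij : i ≠ j) : ‖b i + b j‖ ^ 2 = ‖b i‖ ^ 2 + ‖b j‖ ^ 2 := by
  rw [norm_add_sq_real, b.orthonormal.2 hij]; ring

theorem norm_dualVec (j : Fin n) : ‖dualVec b j‖ = 1 := by
  simp [dualVec, b.orthonormal.1 j]

theorem cliffordRel : CliffordRel (genE b) (genF b) where
  E_sq j := by
    have : form 𝔱 (b j, 0) = -1 := by simp [form_apply]
    rw [genE, ι_sq, this, map_neg, map_one]
  F_sq j := by
    have : form 𝔱 (0, dualVec b j) = -1 := by simp [form_apply, norm_dualVec]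
    rw [genF, ι_sq, this, map_neg, map_one]
  EE i j hij := by
    refine ι_anticomm _ _ ?_
    rw [Prod.mk_add_mk, form_apply, form_apply, form_apply, form_basis b i j hij]; simp [add_comm]
  FF i j hij := by
    refine ι_anticomm _ _ ?_
    have : ‖dualVec b i + dualVec b j‖ = ‖b i + b j‖ := by
      rw [dualVec, dualVec, ← map_add, innerSL_apply_norm]
    rw [Prod.mk_add_mk, form_apply, form_apply, form_apply, this, form_basis b i j hij,
      norm_dualVec, norm_dualVec, b.norm_eq_one, b.norm_eq_one]; simp
  EF i j := by
    refine ι_anticomm _ _ ?_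
    rw [Prod.mk_add_mk, form_apply, form_apply, form_apply]; simp; ring
  star_E j := by simp [genE, TensorProduct.tmul_neg]
  star_F j := by simp [genF, TensorProduct.tmul_neg]

/-- The projection `P = ∏_j ½ (1 - i e_j ε^j)`. -/
noncomputable def proj : Cl 𝔱 := vacuumProj (genE b) (genF b)

theorem ι_eq_sum (m : 𝔱 × StrongDual ℝ 𝔱) :
    (1 ⊗ₜ[ℝ] CliffordAlgebra.ι (form 𝔱) m : Cl 𝔱) =
      ∑ j, (((b.repr m.1 j : ℝ) : ℂ) • genE b j + ((m.2 (b j) : ℝ) : ℂ) • genF b j) := by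
  have hm : m = ∑ j, (b.repr m.1 j • ((b j, 0) : 𝔱 × StrongDual ℝ 𝔱)
      + m.2 (b j) • ((0, dualVec b j) : 𝔱 × StrongDual ℝ 𝔱)) := by
    obtain ⟨v, ξ⟩ := m
    refine Prod.ext ?_ ?_
    · simp [Prod.fst_sum, b.sum_repr]
    · simp only [Prod.snd_sum, Prod.snd_add, Prod.smul_snd, smul_zero, zero_add]
      refine ContinuousLinearMap.ext fun y => ?_
      conv_lhs => rw [← b.sum_repr y]
      simp [dualVec, b.repr_apply_apply, mul_comm]
  conv_lhs => rw [hm]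
  have hs : ∀ (r : ℝ) (x : CliffordAlgebra (form 𝔱)),
      (1 : ℂ) ⊗ₜ[ℝ] (r • x) = (r : ℂ) • ((1 : ℂ) ⊗ₜ[ℝ] x) := by
    intro r x
    rw [TensorProduct.tmul_smul, TensorProduct.smul_tmul', TensorProduct.smul_tmul']
    simp
  simp only [map_sum, map_add, map_smul, TensorProduct.tmul_sum, TensorProduct.tmul_add, hs]
  rfl

theorem mul_proj_mem (x : Cl 𝔱) : x * proj b ∈ wordSpan (genE b) (genF b) := by
  have hc := cliffordRel b
  have key : ∀ y : CliffordAlgebra (form 𝔱),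
      ((1 : ℂ) ⊗ₜ[ℝ] y : Cl 𝔱) * proj b ∈ wordSpan (genE b) (genF b) := by
    intro y
    induction y using CliffordAlgebra.left_induction with
    | algebraMap r =>
      have : ((1 : ℂ) ⊗ₜ[ℝ] algebraMap ℝ (CliffordAlgebra (form 𝔱)) r : Cl 𝔱)
          = (r : ℂ) • 1 := by
        rw [Algebra.algebraMap_eq_smul_one, TensorProduct.tmul_smul, TensorProduct.smul_tmul',
          Algebra.TensorProduct.one_def, TensorProduct.smul_tmul']
        simp
      rw [this, smul_mul_assoc, one_mul]
      exact Submodule.smul_mem _ _ (Submodule.subset_span ⟨[], by simp [proj]⟩)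
    | add x y hx hy => rw [TensorProduct.tmul_add, add_mul]; exact add_mem hx hy
    | ι_mul x m hx =>
      have : ((1 : ℂ) ⊗ₜ[ℝ] (CliffordAlgebra.ι (form 𝔱) m * x) : Cl 𝔱)
          = (1 ⊗ₜ[ℝ] CliffordAlgebra.ι (form 𝔱) m) * (1 ⊗ₜ[ℝ] x) := by simp
      rw [this, mul_assoc, ι_eq_sum b, Finset.sum_mul]
      refine sum_mem fun j _ => ?_
      rw [add_mul, smul_mul_assoc, smul_mul_assoc]
      exact add_mem (Submodule.smul_mem _ _ (hc.E_mul_mem j hx))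
        (Submodule.smul_mem _ _ (hc.F_mul_mem j hx))
  induction x using TensorProduct.induction_on with
  | zero => simp
  | tmul z y =>
    have : (z ⊗ₜ[ℝ] y : Cl 𝔱) = z • (1 ⊗ₜ[ℝ] y) := by rw [TensorProduct.smul_tmul']; simp
    rw [this, smul_mul_assoc]
    exact Submodule.smul_mem _ _ (key y)
  | add x y hx hy => rw [add_mul]; exact add_mem hx hy

theorem exists_corner (x : Cl 𝔱) : ∃ c : ℂ, proj b * x * proj b = c • proj b :=
  (cliffordRel b).corner (mul_proj_mem b) x

theorem proj_ne_zero : proj b ≠ 0 := (cliffordRel b).vacuum_ne_zero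

theorem proj_mul_self : proj b * proj b = proj b := (cliffordRel b).vacuum_mul_self

theorem star_proj : star (proj b) = proj b := (cliffordRel b).star_vacuum

/-- The identification of the corner `P Cℓ P = ℂ P` with `ℂ`: the scalar `c` with
`P x P = c P`. -/
noncomputable def corner (x : Cl 𝔱) : ℂ := (exists_corner b x).choose

theorem corner_spec (x : Cl 𝔱) : proj b * x * proj b = corner b x • proj b :=
  (exists_corner b x).choose_spec

theorem corner_eq {x : Cl 𝔱} {c : ℂ} (h : proj b * x * proj b = c • proj b) : corner b x = c :=
  smul_left_injective ℂ (proj_ne_zero b) ((corner_spec b x).symm.trans h)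

theorem corner_add (x y : Cl 𝔱) : corner b (x + y) = corner b x + corner b y :=
  corner_eq b (by rw [mul_add, add_mul, corner_spec, corner_spec, add_smul])

theorem corner_smul (c : ℂ) (x : Cl 𝔱) : corner b (c • x) = c * corner b x :=
  corner_eq b (by rw [mul_smul_comm, smul_mul_assoc, corner_spec, smul_smul])

theorem corner_star (x : Cl 𝔱) : corner b (star x) = star (corner b x) :=
  corner_eq b (by
    have := congrArg star (corner_spec b x)
    rwa [star_mul, star_mul, star_smul, star_proj, ← mul_assoc] at this)

/-- The space of spinors `𝒮 = Cℓ(𝔱 × 𝔱*) P`. -/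
noncomputable def spinorIdeal : Submodule ℂ (Cl 𝔱) :=
  LinearMap.range (LinearMap.mulRight ℂ (proj b))

/-- The space of spinors as a type. -/
abbrev Spinor : Type _ := spinorIdeal b

theorem Spinor.mul_proj (s : Spinor b) : (s : Cl 𝔱) * proj b = s := by
  obtain ⟨_, x, rfl⟩ := s
  simp [mul_assoc, proj_mul_self]

theorem exists_expansion : ∃ L : List (Cl 𝔱), ∀ s : Spinor b,
    (s : Cl 𝔱) = (L.map fun u => corner b (star u * s) • (u * proj b)).sum ∧
    corner b (star (s : Cl 𝔱) * s)
      = (L.map fun u => star (corner b (star u * s)) * corner b (star u * s)).sum := by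
  obtain ⟨L, hL⟩ := (cliffordRel b).exists_resolution
  have hu : ∀ (u : Cl 𝔱) (s : Spinor b),
      u * proj b * star u * s = corner b (star u * s) • (u * proj b) := by
    intro u s
    rw [← mul_smul_comm, ← corner_spec, mul_assoc (proj b), mul_assoc (star u), s.mul_proj]
    simp only [mul_assoc]
  have h1 : ∀ s : Spinor b,
      (s : Cl 𝔱) = (L.map fun u => corner b (star u * s) • (u * proj b)).sum := by
    intro s
    conv_lhs => rw [← one_mul (s : Cl 𝔱), ← hL, ← List.sum_map_mul_right]
    exact congrArg _ (List.map_congr_left fun u _ => hu u s)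
  refine ⟨L, fun s => ⟨h1 s, corner_eq b ?_⟩⟩
  have h2 : proj b * (star (s : Cl 𝔱) * s) * proj b = star (s : Cl 𝔱) * s := by
    rw [mul_assoc, mul_assoc, s.mul_proj, ← mul_assoc]
    conv_rhs => rw [← s.mul_proj, star_mul, star_proj]
    rw [s.mul_proj]
  have h5 : star (s : Cl 𝔱) * s =
      (L.map fun u => star (s : Cl 𝔱) * (u * vacuumProj (genE b) (genF b) * star u * s)).sum := by
    rw [List.sum_map_mul_left, List.sum_map_mul_right, hL, one_mul]
  rw [h2, h5]
  have h3 : ∀ (l : List (Cl 𝔱)) (f : Cl 𝔱 → ℂ),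
      (l.map f).sum • proj b = (l.map fun u => f u • proj b).sum := by
    intro l f
    induction l with
    | nil => simp
    | cons a l ih => simp [add_smul, ih]
  rw [h3]
  refine congrArg _ (List.map_congr_left fun u _ => ?_)
  have h4 : star (s : Cl 𝔱) * (u * proj b) = star (corner b (star u * s)) • proj b := by
    rw [← corner_star, ← corner_spec, star_mul, star_star, ← mul_assoc]
    conv_lhs => rw [← s.mul_proj, star_mul, star_proj]
    simp only [mul_assoc]
  show star (s : Cl 𝔱) * (u * vacuumProj (genE b) (genF b) * star u * s) = _
  rw [show vacuumProj (genE b) (genF b) = proj b from rfl, hu, mul_smul_comm, h4, smul_smul,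
    mul_comm]

/-- The inner product `⟨s, t⟩ = s* t ∈ P Cℓ P = ℂ`, that is `⟨aP, bP⟩ = P a* b P`. -/
noncomputable abbrev spinorCore : InnerProductSpace.Core ℂ (Spinor b) where
  inner s t := corner b (star (s : Cl 𝔱) * (t : Cl 𝔱))
  conj_inner_symm s t := by
    show star _ = _
    rw [← corner_star, star_mul, star_star]
  re_inner_nonneg s := by
    obtain ⟨L, hL⟩ := exists_expansion b
    rw [(hL s).2]
    have h : ∀ (l : List (Cl 𝔱)) (f : Cl 𝔱 → ℂ),
        0 ≤ RCLike.re ((l.map fun u => star (f u) * f u).sum) := by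
      intro l f
      induction l with
      | nil => simp
      | cons a l ih =>
        rw [List.map_cons, List.sum_cons, map_add]
        refine add_nonneg ?_ ih
        simp only [RCLike.star_def, RCLike.re_to_complex, Complex.mul_re, Complex.conj_re,
          Complex.conj_im]
        nlinarith [mul_self_nonneg (f a).re, mul_self_nonneg (f a).im]
    exact h _ _
  add_left s t u := by
    rw [← corner_add, Submodule.coe_add, star_add, add_mul]
  smul_left s t c := by
    rw [Submodule.coe_smul, star_smul, smul_mul_assoc, corner_smul]; rfl
  definite s hs := by
    obtain ⟨L, hL⟩ := exists_expansion b
    have h : ∀ (l : List (Cl 𝔱)) (f : Cl 𝔱 → ℂ), (l.map fun u => star (f u) * f u).sum = 0 →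
        ∀ u ∈ l, f u = 0 := by
      intro l f hl u hu
      have hnn : ∀ x ∈ l.map (fun u => Complex.normSq (f u)), 0 ≤ x := by
        intro x hx
        obtain ⟨v, -, rfl⟩ := List.mem_map.1 hx
        exact Complex.normSq_nonneg _
      have hsum : (l.map fun u => Complex.normSq (f u)).sum = 0 := by
        have hcast : ∀ l : List (Cl 𝔱), (((l.map fun u => Complex.normSq (f u)).sum : ℝ) : ℂ)
            = (l.map fun u => star (f u) * f u).sum := by
          intro l
          induction l with
          | nil => simp
          | cons a l ih => simp [ih, Complex.normSq_eq_conj_mul_self]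
        have := (hcast l).trans hl
        exact_mod_cast this
      have := List.all_zero_of_le_zero_le_of_sum_eq_zero hnn hsum (List.mem_map_of_mem hu)
      exact Complex.normSq_eq_zero.1 this
    rw [(hL s).2] at hs
    refine Subtype.ext ?_
    rw [(hL s).1]
    refine List.sum_eq_zero fun x hx => ?_
    obtain ⟨u, hu, rfl⟩ := List.mem_map.1 hx
    show corner b (star u * s) • (u * proj b) = 0
    rw [h L _ hs u hu, zero_smul]

noncomputable instance : NormedAddCommGroup (Spinor b) :=
  (spinorCore b).toNormedAddCommGroup

noncomputable instance : InnerProductSpace ℂ (Spinor b) :=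
  InnerProductSpace.ofCore (spinorCore b).toCore

theorem spinor_inner (s t : Spinor b) : inner ℂ s t = corner b (star (s : Cl 𝔱) * (t : Cl 𝔱)) :=
  rfl

theorem mul_proj_mem_spinorIdeal (x : Cl 𝔱) : x * proj b ∈ spinorIdeal b := ⟨x, rfl⟩

open Classical in
instance : FiniteDimensional ℂ (Spinor b) := by
  obtain ⟨L, hL⟩ := exists_expansion b
  let v : Cl 𝔱 → Spinor b := fun u => ⟨u * proj b, mul_proj_mem_spinorIdeal b u⟩
  refine ⟨⟨(L.map v).toFinset, eq_top_iff.2 fun s _ => ?_⟩⟩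
  have hs : s = (L.map fun u => corner b (star u * s) • v u).sum := by
    refine (spinorIdeal b).injective_subtype ?_
    rw [map_list_sum, List.map_map]
    exact (hL s).1
  rw [hs]
  refine list_sum_mem fun x hx => ?_
  obtain ⟨u, hu, rfl⟩ := List.mem_map.1 hx
  refine Submodule.smul_mem _ _ (Submodule.subset_span ?_)
  exact List.mem_toFinset.2 (List.mem_map_of_mem hu)

theorem mul_mem_spinorIdeal (c : Cl 𝔱) (s : Spinor b) : c * (s : Cl 𝔱) ∈ spinorIdeal b := by
  rw [← s.mul_proj, ← mul_assoc]
  exact mul_proj_mem_spinorIdeal b _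

/-- Clifford multiplication: the action of `c ∈ Cℓ(𝔱 × 𝔱*)` on spinors by left multiplication. -/
noncomputable def cliffordMul (c : Cl 𝔱) : Spinor b →L[ℂ] Spinor b :=
  LinearMap.toContinuousLinearMap
    { toFun := fun s => ⟨c * (s : Cl 𝔱), mul_mem_spinorIdeal b c s⟩
      map_add' := fun s t => Subtype.ext (by simp [mul_add])
      map_smul' := fun a s => Subtype.ext (mul_smul_comm a c (s : Cl 𝔱)) }

theorem cliffordMul_apply (c : Cl 𝔱) (s : Spinor b) :
    (cliffordMul b c s : Cl 𝔱) = c * (s : Cl 𝔱) := rfl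

/-- `P` as a spinor. -/
noncomputable def vacuum : Spinor b := ⟨proj b, 1, by simp⟩

/-- The even part of `Cℓ(𝔱 × 𝔱*)`. -/
noncomputable def evenCl : Submodule ℂ (Cl 𝔱) :=
  (CliffordAlgebra.evenOdd (form 𝔱) 0).baseChange ℂ

/-- The even part of the spinor space, for the grading induced by that of `Cℓ(𝔱 × 𝔱*)`. -/
noncomputable def evenSpinor : Submodule ℂ (Spinor b) :=
  evenCl.comap (spinorIdeal b).subtype

end Clifford

section Operator

open MeasureTheory SchwartzMap LineDeriv

variable {𝔱 : Type*} [NormedAddCommGroup 𝔱] [InnerProductSpace ℝ 𝔱] [FiniteDimensional ℝ 𝔱]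
  [MeasurableSpace 𝔱] [BorelSpace 𝔱] {n : ℕ} (b : OrthonormalBasis (Fin n) ℝ 𝔱)

/-- The Hilbert space `L²(𝔱) ⊗ 𝒮`, realised as the space of square integrable `𝒮`-valued
functions on `𝔱`, for Lebesgue measure. -/
abbrev L2Spinor : Type _ := Lp (Spinor b) 2 (volume : Measure 𝔱)

/-- `f ↦ ∑ⱼ ε^j ∂f/∂y^j - 2πi ∑ⱼ y^j e_j f` on Schwartz functions with values in `𝒮`. -/
noncomputable def schwartzOp : 𝓢(𝔱, Spinor b) →ₗ[ℂ] 𝓢(𝔱, Spinor b) where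
  toFun f := ∑ j, (postcompCLM (cliffordMul b (genF b j)) (∂_{b j} f)
    - (2 * Real.pi * Complex.I) •
      smulLeftCLM (Spinor b) (fun y : 𝔱 => ((dualVec b j y : ℝ) : ℂ))
        (postcompCLM (cliffordMul b (genE b j)) f))
  map_add' f g := by
    rw [← Finset.sum_add_distrib]
    refine Finset.sum_congr rfl fun j _ => ?_
    simp only [map_add, lineDerivOp_add, smul_add]
    abel
  map_smul' c f := by
    rw [Finset.smul_sum]
    refine Finset.sum_congr rfl fun j _ => ?_
    simp only [map_smul, lineDerivOp_smul, RingHom.id_apply, smul_sub]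
    rw [smul_comm]

theorem schwartzOp_apply (f : 𝓢(𝔱, Spinor b)) (y : 𝔱) :
    schwartzOp b f y = ∑ j, (cliffordMul b (genF b j) (lineDeriv ℝ f y (b j))
      - (2 * Real.pi * Complex.I * (inner ℝ (b j) y : ℝ)) • cliffordMul b (genE b j) (f y)) := by
  have hg : ∀ j, (fun y : 𝔱 => ((dualVec b j y : ℝ) : ℂ)).HasTemperateGrowth := fun j => by
    fun_prop
  simp only [schwartzOp, LinearMap.coe_mk, AddHom.coe_mk, _root_.sum_apply,
    _root_.sub_apply, _root_.smul_apply, smulLeftCLM_apply_apply (hg _),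
    postcompCLM_apply, lineDerivOp_apply, smul_smul]
  rfl

/-- The operator on `L²(𝔱) ⊗ 𝒮` with domain the Schwartz functions. -/
noncomputable def Q0Schwartz : L2Spinor b →ₗ.[ℂ] L2Spinor b where
  domain := LinearMap.range (toLpCLM ℂ (Spinor b) 2 (volume : Measure 𝔱)).toLinearMap
  toFun := (toLpCLM ℂ (Spinor b) 2 (volume : Measure 𝔱)).toLinearMap ∘ₗ schwartzOp b ∘ₗ
    (LinearEquiv.ofInjective (toLpCLM ℂ (Spinor b) 2 (volume : Measure 𝔱)).toLinearMap
      (injective_toLp 2 (volume : Measure 𝔱))).symm.toLinearMap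

/-- The unbounded operator `Q₀`, the closure of its restriction to Schwartz functions. -/
noncomputable def Q0 : L2Spinor b →ₗ.[ℂ] L2Spinor b := (Q0Schwartz b).closure

/-- The even part of `L²(𝔱) ⊗ 𝒮`, where `L²(𝔱)` is even. -/
noncomputable def evenL2 : Submodule ℂ (L2Spinor b) where
  carrier := {f | ∀ᵐ y, f y ∈ evenSpinor b}
  zero_mem' := by
    filter_upwards [Lp.coeFn_zero (Spinor b) 2 (volume : Measure 𝔱)] with y hy
    rw [hy]; exact zero_mem _
  add_mem' {f g} hf hg := by
    filter_upwards [hf, hg, Lp.coeFn_add f g] with y h1 h2 h3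
    rw [h3]; exact add_mem h1 h2
  smul_mem' c f hf := by
    filter_upwards [hf, Lp.coeFn_smul c f] with y h1 h2
    rw [h2]; exact Submodule.smul_mem _ _ h1

end Operator

section Unbounded

variable {H : Type*} [NormedAddCommGroup H] [InnerProductSpace ℂ H]

/-- `R` is the resolvent `(T - z)⁻¹`: a bounded operator on `H`, with range in the domain of `T`,
that is a two-sided inverse of `T - z : dom T → H`. -/
def IsResolvent (T : H →ₗ.[ℂ] H) (z : ℂ) (R : H →L[ℂ] H) : Prop :=
  (∀ x : T.domain, R (T x - z • (x : H)) = x) ∧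
    ∀ y : H, ∃ x : T.domain, (x : H) = R y ∧ T x - z • (x : H) = y

/-- `T` has compact resolvent: `(T - z)⁻¹` exists for some `z`, and it is a compact operator
whenever it exists. -/
def HasCompactResolvent (T : H →ₗ.[ℂ] H) : Prop :=
  (∃ z R, IsResolvent T z R) ∧ ∀ z R, IsResolvent T z R → IsCompactOperator R

/-- The kernel of an unbounded operator, as a subspace of the ambient space. -/
def kernel (T : H →ₗ.[ℂ] H) : Submodule ℂ H := (LinearMap.ker T.toFun).map T.domain.subtype

end Unbounded

end Ladder

/-! The operator is a supersymmetric harmonic oscillator. Put `a_j = ∂_j + 2π y^j`, `a'_j = -∂_j +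
2π y^j`, `c_j = ½(ε^j - i e_j)`, `d_j = -½(ε^j + i e_j)`. On Schwartz functions it is `D = ∑ (c_j
a_j + d_j a'_j)` (`schwartzOp_eq`). Since `[a_i, a'_j] = 4π δ_ij` and `c_i d_j + d_j c_i = δ_ij`,
while the remaining relations make the other terms cancel, `D² = ∑ a'_j a_j + 4π N` with `N = ∑ c_j
d_j` (`OscillatorRel.sq`). Here `N = ∑ (1 - p_j)` with `p_j = ½(1 - i e_j ε^j)` is a sum of
orthogonal projections on spinors, hence Hermitian and nonnegative.

If `N s = μ s`, a word of `k` creation operators applied to `e^{-π|y|²} s` is an eigenvector of `D²`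
with eigenvalue `4π(k + μ)` (`OscillatorRel.sq_fockVec`). For each fixed `s` the span of these
vectors contains every `⟪ξ, y⟫^k e^{-π|y|²} s`. As `s` runs over an eigenbasis of `N` they are total
in `L²`: a function orthogonal to all of them, times the Gaussian, has vanishing Fourier transform
(`eq_zero_of_integral_gaussian`). Each bound on the eigenvalue leaves only finitely many indices.

The rest is abstract (`SymmGraph.closure_of_eigenvectors`). If `D² ψ = λ ψ` and `z = ±i`, then `(D -
z)(Dψ + zψ) = (λ + 1) ψ`, so `D - z` has dense range; symmetry makes the range of the closure of `D
- z` closed, which gives self-adjointness. The resolvent `R` at `i` satisfies `R* R ψ = (λ + 1)⁻¹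
ψ`, with eigenvalues tending to zero, so it is compact. The kernel is spanned by the `ψ` with `λ =
0`, that is `k = 0` and `N s = 0`; then `p_j s = s` for all `j`, so `s = P s ∈ ℂP`
(`mem_span_vacuum`). Evenness holds because `P` is a polynomial in products of two generators. -/

namespace Ladder

/-! ### Symmetric operators with a total family of eigenvectors of the square -/

section Abstract

open InnerProductSpace LinearPMap

variable {H : Type*} [NormedAddCommGroup H] [InnerProductSpace ℂ H]

/-- A symmetric relation on a Hilbert space. -/
def SymmGraph (G : Submodule ℂ (H × H)) : Prop :=
  ∀ p ∈ G, ∀ q ∈ G, inner ℂ p.2 q.1 = inner ℂ p.1 q.2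

/-- The identity is closed in each of the two pairs separately, so it extends to the closure one
variable at a time. This is why symmetry is formulated for graphs. -/
theorem SymmGraph.closure {G : Submodule ℂ (H × H)} (hG : SymmGraph G) :
    SymmGraph G.topologicalClosure := by
  have h1 : ∀ p ∈ G, ∀ q ∈ G.topologicalClosure, inner ℂ p.2 q.1 = inner ℂ p.1 q.2 := by
    intro p hp q hq
    have hc : IsClosed {q : H × H | inner ℂ p.2 q.1 = inner ℂ p.1 q.2} :=
      isClosed_eq (by fun_prop) (by fun_prop)
    exact closure_minimal (fun q hq => hG p hp q hq) hc hq
  intro p hp q hq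
  have hc : IsClosed {p : H × H | inner ℂ p.2 q.1 = inner ℂ p.1 q.2} :=
    isClosed_eq (by fun_prop) (by fun_prop)
  exact closure_minimal (fun p hp => h1 p hp q hq) hc hp

theorem SymmGraph.isFormalAdjoint {T : H →ₗ.[ℂ] H} (hT : SymmGraph T.graph) :
    T.IsFormalAdjoint T := fun x y =>
  hT _ (T.mem_graph x) _ (T.mem_graph y)

theorem SymmGraph.inner_self_im {G : Submodule ℂ (H × H)} (hG : SymmGraph G) {p : H × H}
    (hp : p ∈ G) : (inner ℂ p.2 p.1).im = 0 := by
  have h := hG p hp p hp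
  rw [← inner_conj_symm p.1 p.2] at h
  exact Complex.conj_eq_iff_im.1 h.symm

/-- By symmetry `⟪p.2, p.1⟫` is real, so for purely imaginary `z` the cross term has real part zero.
-/
theorem SymmGraph.norm_sub_smul_sq {G : Submodule ℂ (H × H)} (hG : SymmGraph G) {p : H × H}
    (hp : p ∈ G) {z : ℂ} (hz : z.re = 0) :
    ‖p.2 - z • p.1‖ ^ 2 = ‖p.2‖ ^ 2 + ‖z‖ ^ 2 * ‖p.1‖ ^ 2 := by
  rw [@norm_sub_sq ℂ, norm_smul, inner_smul_right]
  have h : RCLike.re (z * inner ℂ p.2 p.1) = 0 := by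
    simp [hz, hG.inner_self_im hp]
  rw [h]; ring

theorem SymmGraph.isClosable [CompleteSpace H] {T : H →ₗ.[ℂ] H} (hT : SymmGraph T.graph)
    (hd : Dense (T.domain : Set H)) : T.IsClosable :=
  isClosable_iff_exists_closed_extension.2
    ⟨T†, adjoint_isClosed hd, hT.isFormalAdjoint.le_adjoint hd⟩

/-- The map `p ↦ p.2 - z p.1` is bounded below on the complete space `G`, so its range is closed;
`h0` says that the orthogonal complement of the range is zero. -/
theorem SymmGraph.exists_eq_of_dense [CompleteSpace H] {G : Submodule ℂ (H × H)} (hG : SymmGraph G)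
    (hc : IsClosed (G : Set (H × H))) {z : ℂ} (hz : z.re = 0) (hz1 : ‖z‖ = 1)
    (h0 : ∀ y : H, (∀ p ∈ G, inner ℂ (p.2 - z • p.1) y = 0) → y = 0) (y : H) :
    ∃ p ∈ G, p.2 - z • p.1 = y := by
  let F : G →L[ℂ] H := ((ContinuousLinearMap.snd ℂ H H) - z • ContinuousLinearMap.fst ℂ H H) ∘L
    G.subtypeL
  have hF : ∀ p : G, F p = (p : H × H).2 - z • (p : H × H).1 := fun p => rfl
  have hlow : ∀ p : G, ‖p‖ ≤ (1 : NNReal) * ‖F p‖ := by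
    intro p
    have h := hG.norm_sub_smul_sq p.2 hz
    rw [hz1, ← hF] at h
    rw [NNReal.coe_one, one_mul, Submodule.coe_norm, Prod.norm_def]
    refine max_le ?_ ?_
    · exact abs_le_of_sq_le_sq' (by nlinarith [sq_nonneg ‖(p : H × H).2‖]) (norm_nonneg _) |>.2
    · exact abs_le_of_sq_le_sq' (by nlinarith [sq_nonneg ‖(p : H × H).1‖]) (norm_nonneg _) |>.2
  have : CompleteSpace G := hc.completeSpace_coe
  have hr : IsClosed (Set.range F) :=
    (F.antilipschitz_of_bound hlow).isClosed_range F.uniformContinuous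
  have hr' : IsClosed ((LinearMap.range F.toLinearMap : Submodule ℂ H) : Set H) := by
    simpa using! hr
  have htop : LinearMap.range F.toLinearMap = ⊤ := by
    rw [← hr'.submodule_topologicalClosure_eq, Submodule.topologicalClosure_eq_top_iff,
      Submodule.eq_bot_iff]
    intro v hv
    refine h0 v fun p hp => ?_
    exact hv _ ⟨⟨p, hp⟩, rfl⟩
  obtain ⟨p, hp⟩ := LinearMap.range_eq_top.1 htop y
  exact ⟨p, p.2, hp⟩

/-- For `(y, y')` in the graph of the adjoint, solve `(A - z) p = y' - z y`. Then `y - p` is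
orthogonal to the range of `A - z̄`, which is everything. -/
theorem SymmGraph.isSelfAdjoint [CompleteSpace H] {A : H →ₗ.[ℂ] H} (hA : SymmGraph A.graph)
    (hd : Dense (A.domain : Set H)) {z : ℂ}
    (h1 : ∀ y : H, ∃ p ∈ A.graph, p.2 - z • p.1 = y)
    (h2 : ∀ y : H, ∃ p ∈ A.graph, p.2 - (starRingEnd ℂ z) • p.1 = y) : IsSelfAdjoint A := by
  rw [isSelfAdjoint_def]
  refine le_antisymm ?_ (hA.isFormalAdjoint.le_adjoint hd)
  refine le_of_le_graph ?_
  rintro ⟨y, y'⟩ hy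
  have hyA : ∀ p ∈ A.graph, inner ℂ y' p.1 = inner ℂ y p.2 := by
    rintro ⟨_, _⟩ hp
    obtain ⟨v, rfl, rfl⟩ := (mem_graph_iff _).1 hp
    obtain ⟨w, rfl, rfl⟩ := (mem_graph_iff _).1 hy
    exact adjoint_isFormalAdjoint hd w v
  obtain ⟨p, hp, hpy⟩ := h1 (y' - z • y)
  obtain ⟨q, hq, hqy⟩ := h2 (y - p.1)
  have hyp : y - p.1 = 0 := by
    rw [← inner_self_eq_zero (𝕜 := ℂ)]
    -- Writing one copy of `y - p` as `(A - z̄) q` lets the adjoint relation and the symmetry of `A`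
    -- move everything onto `q`.
    nth_rewrite 2 [← hqy]
    have e1 := hyA q hq
    have e2 := hA p hp q hq
    have e3 : inner ℂ (p.2 - z • p.1) q.1 = inner ℂ (y' - z • y) q.1 := by rw [hpy]
    simp only [inner_sub_left, inner_sub_right, inner_smul_left, inner_smul_right] at e3 ⊢
    rw [← e1, ← e2]
    linear_combination -e3
  have h3 : y = p.1 := sub_eq_zero.1 hyp
  have h4 : y' = p.2 := by
    rw [h3] at hpy
    exact (sub_left_inj.1 hpy).symm
  rw [h3, h4]
  exact hp

theorem exists_isResolvent {A : H →ₗ.[ℂ] H} (hA : SymmGraph A.graph) {z : ℂ}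
    (hz : z.re = 0) (hz1 : ‖z‖ = 1)
    (h : ∀ y : H, ∃ p ∈ A.graph, p.2 - z • p.1 = y) : ∃ R, IsResolvent A z R := by
  let F : A.domain →ₗ[ℂ] H := A.toFun - z • A.domain.subtype
  have hF : ∀ x, F x = A x - z • (x : H) := fun x => rfl
  have hb : ∀ x : A.domain, ‖(x : H)‖ ≤ ‖F x‖ := by
    intro x
    have h := hA.norm_sub_smul_sq (A.mem_graph x) hz
    rw [hz1] at h
    rw [hF]
    exact abs_le_of_sq_le_sq' (by nlinarith [sq_nonneg ‖A x‖]) (norm_nonneg _) |>.2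
  have hinj : Function.Injective F := by
    rw [← LinearMap.ker_eq_bot, LinearMap.ker_eq_bot']
    intro x hx
    have := hb x
    rw [hx, norm_zero] at this
    exact Subtype.ext (norm_le_zero_iff.1 this)
  have hsurj : Function.Surjective F := by
    intro y
    obtain ⟨⟨_, _⟩, hp, hpy⟩ := h y
    obtain ⟨v, rfl, rfl⟩ := (mem_graph_iff _).1 hp
    exact ⟨v, hpy⟩
  let e := LinearEquiv.ofBijective F ⟨hinj, hsurj⟩
  refine ⟨(A.domain.subtype ∘ₗ e.symm.toLinearMap).mkContinuous 1 fun y => ?_, ?_, ?_⟩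
  · rw [one_mul]
    refine (hb (e.symm y)).trans_eq ?_
    exact congrArg norm (e.apply_symm_apply y)
  · intro x
    exact congrArg Subtype.val (e.symm_apply_apply x)
  · intro y
    exact ⟨e.symm y, rfl, e.apply_symm_apply y⟩

/-- The resolvent identity `S = R (1 + (w - z) S)` transfers compactness from one resolvent to every
other. -/
theorem IsResolvent.isCompactOperator {A : H →ₗ.[ℂ] H} {z w : ℂ} {R S : H →L[ℂ] H}
    (hR : IsResolvent A z R) (hc : IsCompactOperator R) (hS : IsResolvent A w S) :
    IsCompactOperator S := by
  have : S = R ∘L (ContinuousLinearMap.id ℂ H + (w - z) • S) := by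
    ext y
    obtain ⟨x, hx, hxy⟩ := hS.2 y
    have h := hR.1 x
    simp only [ContinuousLinearMap.comp_apply, _root_.add_apply, ContinuousLinearMap.id_apply,
      _root_.smul_apply, ← hx]
    rw [← h]
    congr 1
    rw [h, ← hxy]
    module
  rw [this]
  exact hc.comp_clm _

/-- A bounded operator `R` is compact if `R* R` has a total family of eigenvectors whose
eigenvalues accumulate only at zero. -/
theorem isCompactOperator_of_eigenvectors [CompleteSpace H] {ι : Type*} (R : H →L[ℂ] H) (ψ : ι → H) (κ : ι → ℝ)
    (hκ : ∀ i v, inner ℂ (R v) (R (ψ i)) = κ i * inner ℂ v (ψ i))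
    (htot : ∀ f, (∀ i, inner ℂ (ψ i) f = 0) → f = 0)
    (hfin : ∀ ε > 0, {i | ε ≤ |κ i|}.Finite) : IsCompactOperator R := by
  let B : H →L[ℂ] H := R.adjoint ∘L R
  have hB : ∀ v w, inner ℂ v (B w) = inner ℂ (R v) (R w) := fun v w => by
    simp [B, ContinuousLinearMap.adjoint_inner_right]
  have hBψ : ∀ i, B (ψ i) = (κ i : ℂ) • ψ i := fun i =>
    ext_inner_left ℂ fun v => by rw [hB, hκ, inner_smul_right]
  have hsymm : B.toLinearMap.IsSymmetric := by
    intro v w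
    show inner ℂ (B v) w = inner ℂ v (B w)
    rw [← inner_conj_symm, hB, hB, inner_conj_symm]
  have hort := hsymm.orthogonalFamily_eigenspaces
  have hmem : ∀ i, ψ i ∈ Module.End.eigenspace B.toLinearMap (κ i : ℂ) := fun i =>
    Module.End.mem_eigenspace_iff.2 (hBψ i)
  -- Compact operators are norm closed, so it suffices to approximate `R` by finite rank operators
  -- `R ∘ proj_F`, with `F` the span of the eigenvectors of large eigenvalue.
  refine isClosed_setOfPred_isCompactOperator.closure_subset (s := {f : H →L[ℂ] H |
    IsCompactOperator f}) ?_
  rw [Metric.mem_closure_iff]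
  intro ε hε
  obtain ⟨δ, hδ, hδε⟩ : ∃ δ > 0, Real.sqrt δ < ε :=
    ⟨(ε / 2) ^ 2, by positivity, by rw [Real.sqrt_sq (by positivity)]; linarith⟩
  let F : Submodule ℂ H := Submodule.span ℂ (ψ '' {i | δ ≤ |κ i|})
  let U : Submodule ℂ H := ⨆ k : {k : ℂ // ‖k‖ < δ}, Module.End.eigenspace B.toLinearMap (k : ℂ)
  have : FiniteDimensional ℂ F := FiniteDimensional.span_of_finite ℂ ((hfin δ hδ).image ψ)
  -- Any `u ⊥ U` lies in `F`: `u - proj_F u` is orthogonal to the `ψ i` of large eigenvalue by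
  -- construction, and to those of small eigenvalue because `U` and `F` are orthogonal; totality
  -- makes it zero.
  have hFU : Fᗮ ≤ U.topologicalClosure := by
    rw [← Submodule.orthogonal_orthogonal_eq_closure]
    intro v hv
    refine (Submodule.mem_orthogonal _ _).2 fun u hu => ?_
    have hPu : u - F.starProjection u = 0 := by
      refine htot _ fun i => ?_
      by_cases hi : δ ≤ |κ i|
      · exact F.sub_starProjection_mem_orthogonal u _ (Submodule.subset_span ⟨i, hi, rfl⟩)
      · have hiU : ψ i ∈ U := by
          refine Submodule.mem_iSup_of_mem ⟨(κ i : ℂ), ?_⟩ (hmem i)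
          simpa using hi
        have h1 : inner ℂ (ψ i) u = 0 := hu _ hiU
        have h2 : F ≤ (Submodule.span ℂ {ψ i})ᗮ := by
          refine Submodule.span_le.2 ?_
          rintro _ ⟨j, hj, rfl⟩
          refine Submodule.mem_orthogonal_singleton_iff_inner_right.2 ?_
          have hne : (κ i : ℂ) ≠ (κ j : ℂ) := by
            intro h
            rw [Complex.ofReal_inj] at h
            exact hi (h ▸ hj)
          exact hort hne ⟨_, hmem i⟩ ⟨_, hmem j⟩
        rw [inner_sub_right, h1, Submodule.mem_orthogonal_singleton_iff_inner_right.1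
          (h2 (F.starProjection_apply_mem u)), sub_zero]
    have hu : u ∈ F := by
      rw [sub_eq_zero.1 hPu]
      exact F.starProjection_apply_mem u
    exact hv u hu
  have hBU : ∀ u ∈ U, ‖B u‖ ≤ δ * ‖u‖ := by
    intro u hu
    obtain ⟨f, hf, rfl⟩ := (Submodule.mem_iSup_iff_exists_finsupp _ _).1 hu
    have hort' : OrthogonalFamily ℂ
        (fun k : {k : ℂ // ‖k‖ < δ} => Module.End.eigenspace B.toLinearMap (k : ℂ))
        fun k => (Module.End.eigenspace B.toLinearMap (k : ℂ)).subtypeₗᵢ :=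
      hort.comp Subtype.val_injective
    let g : ∀ k : {k : ℂ // ‖k‖ < δ}, Module.End.eigenspace B.toLinearMap (k : ℂ) :=
      fun k => ⟨f k, hf k⟩
    have e1 := hort'.norm_sum g f.support
    have e2 := hort'.norm_sum (fun k => (k : ℂ) • g k) f.support
    have e3 : B (f.sum fun _ x => x) = ∑ k ∈ f.support, (k : ℂ) • f k := by
      rw [Finsupp.sum, map_sum]
      exact Finset.sum_congr rfl fun k _ => Module.End.mem_eigenspace_iff.1 (hf k)
    refine abs_le_of_sq_le_sq' ?_ (by positivity) |>.2
    rw [e3, mul_pow]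
    calc ‖∑ k ∈ f.support, (k : ℂ) • f k‖ ^ 2
        = ∑ k ∈ f.support, ‖(k : ℂ) • g k‖ ^ 2 := e2
      _ ≤ ∑ k ∈ f.support, δ ^ 2 * ‖g k‖ ^ 2 := by
          refine Finset.sum_le_sum fun k _ => ?_
          rw [norm_smul, mul_pow]
          gcongr
          exact k.2.le
      _ = δ ^ 2 * ‖f.sum fun _ x => x‖ ^ 2 := by
          rw [← Finset.mul_sum, ← e1]; rfl
  -- This comes from `‖R u‖² = ⟪u, B u⟫ ≤ δ ‖u‖²` on `U`, extended by continuity.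
  have hRU : ∀ u ∈ U.topologicalClosure, ‖R u‖ ≤ Real.sqrt δ * ‖u‖ := by
    intro u hu
    have hc : IsClosed {u : H | ‖R u‖ ≤ Real.sqrt δ * ‖u‖} :=
      isClosed_le (by fun_prop) (by fun_prop)
    refine closure_minimal (fun u hu => ?_) hc hu
    show ‖R u‖ ≤ _
    refine abs_le_of_sq_le_sq' ?_ (by positivity) |>.2
    rw [mul_pow, Real.sq_sqrt hδ.le, ← inner_self_eq_norm_sq (𝕜 := ℂ), ← hB]
    calc RCLike.re (inner ℂ u (B u)) ≤ ‖u‖ * ‖B u‖ :=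
          (RCLike.re_le_norm _).trans (norm_inner_le_norm _ _)
      _ ≤ ‖u‖ * (δ * ‖u‖) := by gcongr; exact hBU u hu
      _ = δ * ‖u‖ ^ 2 := by ring
  refine ⟨R ∘L F.starProjection, ?_, ?_⟩
  · have : R ∘L F.starProjection = (R ∘L F.subtypeL) ∘L F.orthogonalProjectionOnto := rfl
    show IsCompactOperator (R ∘L F.starProjection)
    rw [this]
    have : ProperSpace F := FiniteDimensional.proper ℂ F
    have hRF : IsCompactOperator (R ∘L F.subtypeL) :=
      isCompactOperator_of_locallyCompactSpace_rng (R ∘L F.subtypeL)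
    exact hRF.comp_clm _
  · rw [dist_eq_norm]
    refine lt_of_le_of_lt (ContinuousLinearMap.opNorm_le_bound _ (Real.sqrt_nonneg δ) fun y => ?_) hδε
    have h1 : (R - R ∘L F.starProjection) y = R (y - F.starProjection y) := by simp
    rw [h1]
    refine (hRU _ (hFU (F.sub_starProjection_mem_orthogonal y))).trans ?_
    gcongr
    have := Submodule.norm_sq_eq_add_norm_sq_starProjection y F
    rw [F.starProjection_orthogonal_val] at this
    refine abs_le_of_sq_le_sq' ?_ (norm_nonneg _) |>.2
    nlinarith [sq_nonneg ‖F.starProjection y‖]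

/-- The kernel of a symmetric operator with a total family of eigenvectors of its square. -/
theorem SymmGraph.kernel_eq_span {ι : Type*} {A : H →ₗ.[ℂ] H} (hA : SymmGraph A.graph)
    (ψ φ : ι → H) (lam : ι → ℝ)
    (hψ : ∀ i, (ψ i, φ i) ∈ A.graph) (hφ : ∀ i, (φ i, (lam i : ℂ) • ψ i) ∈ A.graph)
    (htot : ∀ f, (∀ i, inner ℂ (ψ i) f = 0) → f = 0) (hfin : {i | lam i = 0}.Finite) :
    kernel A = Submodule.span ℂ (ψ '' {i | lam i = 0}) := by
  have hker : ∀ f, f ∈ kernel A ↔ (f, (0 : H)) ∈ A.graph := by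
    intro f
    rw [mem_graph_iff, kernel, Submodule.mem_map]
    constructor
    · rintro ⟨y, hy, rfl⟩; exact ⟨y, rfl, hy⟩
    · rintro ⟨y, h1, h2⟩; exact ⟨y, h2, h1⟩
  -- Symmetry moves `A` from `φ i` to `f`: `λ ⟪ψ, f⟫ = ⟪A φ, f⟫ = ⟪φ, A f⟫ = 0`.
  have hort : ∀ f ∈ kernel A, ∀ i, lam i ≠ 0 → inner ℂ (ψ i) f = 0 := by
    intro f hf i hi
    have h1 := hA _ (hφ i) _ ((hker f).1 hf)
    simp only [inner_zero_right, inner_smul_left] at h1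
    exact (mul_eq_zero.1 h1).resolve_left (by simpa using hi)
  have hle : Submodule.span ℂ (ψ '' {i | lam i = 0}) ≤ kernel A := by
    refine Submodule.span_le.2 ?_
    rintro _ ⟨i, hi, rfl⟩
    refine (hker _).2 ?_
    -- This reads `λ ‖ψ‖² = ‖φ‖²`, so `λ = 0` forces `φ = A ψ = 0`.
    have h1 := hA _ (hφ i) _ (hψ i)
    rw [show lam i = 0 from hi] at h1
    simp only [Complex.ofReal_zero, zero_smul, inner_zero_left] at h1
    have h2 := hψ i
    rwa [inner_self_eq_zero.1 h1.symm] at h2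
  refine le_antisymm (fun f hf => ?_) hle
  set F := Submodule.span ℂ (ψ '' {i | lam i = 0})
  have : FiniteDimensional ℂ F := FiniteDimensional.span_of_finite ℂ (hfin.image ψ)
  have : f - F.starProjection f = 0 := by
    refine htot _ fun i => ?_
    by_cases hi : lam i = 0
    · exact F.sub_starProjection_mem_orthogonal f _ (Submodule.subset_span ⟨i, hi, rfl⟩)
    · exact hort _ (sub_mem hf (hle (F.starProjection_apply_mem f))) i hi
  rw [sub_eq_zero.1 this]
  exact F.starProjection_apply_mem f

/-- A symmetric operator `T` such that `T²` has a total family of eigenvectors, with finitely many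
eigenvalues below each bound, is essentially self-adjoint with compact resolvent. -/
theorem SymmGraph.closure_of_eigenvectors [CompleteSpace H] {ι : Type*} {T : H →ₗ.[ℂ] H}
    (hT : SymmGraph T.graph)
    (ψ φ : ι → H) (lam : ι → ℝ) (hlam : ∀ i, 0 ≤ lam i)
    (hψ : ∀ i, (ψ i, φ i) ∈ T.graph) (hφ : ∀ i, (φ i, (lam i : ℂ) • ψ i) ∈ T.graph)
    (htot : ∀ f, (∀ i, inner ℂ (ψ i) f = 0) → f = 0) (hfin : ∀ C, {i | lam i ≤ C}.Finite) :
    IsSelfAdjoint T.closure ∧ HasCompactResolvent T.closure ∧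
      kernel T.closure = Submodule.span ℂ (ψ '' {i | lam i = 0}) := by
  have hd : Dense (T.domain : Set H) := by
    rw [Submodule.dense_iff_topologicalClosure_eq_top, Submodule.topologicalClosure_eq_top_iff,
      Submodule.eq_bot_iff]
    refine fun v hv => htot v fun i => hv _ ?_
    exact mem_domain_of_mem_graph (hψ i)
  have hcl := hT.isClosable hd
  have hA : SymmGraph T.closure.graph := by
    rw [← hcl.graph_closure_eq_closure_graph]
    exact hT.closure
  have hle := le_graph_of_le T.le_closure
  have hdA : Dense (T.closure.domain : Set H) := hd.mono T.le_closure.1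
  have hne : ∀ i, (lam i + 1 : ℂ) ≠ 0 := by
    intro i
    have h : lam i + 1 ≠ 0 := by linarith [hlam i]
    exact_mod_cast h
  have key : ∀ z : ℂ, z * z = -1 → ∀ i,
      (φ i + z • ψ i, (lam i : ℂ) • ψ i + z • φ i) ∈ T.closure.graph := by
    intro z hz i
    have h := add_mem (hφ i) (T.graph.smul_mem z (hψ i))
    exact hle h
  have key2 : ∀ z : ℂ, z * z = -1 → ∀ i,
      ((lam i : ℂ) • ψ i + z • φ i) - z • (φ i + z • ψ i) = (lam i + 1 : ℂ) • ψ i := by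
    intro z hz i
    rw [smul_add, smul_smul, hz]
    module
  have hsurj : ∀ z : ℂ, z * z = -1 → z.re = 0 → ‖z‖ = 1 →
      ∀ y : H, ∃ p ∈ T.closure.graph, p.2 - z • p.1 = y := by
    intro z hz hz0 hz1
    refine hA.exists_eq_of_dense hcl.closure_isClosed hz0 hz1 fun y hy => htot y fun i => ?_
    have h := hy _ (key z hz i)
    simp only [key2 z hz, inner_smul_left] at h
    refine (mul_eq_zero.1 h).resolve_left ?_
    have := hne i
    simpa using this
  have hI := hsurj Complex.I Complex.I_mul_I Complex.I_re Complex.norm_I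
  -- The conjugate `-i` is the other square root of `-1`, so the same argument applies.
  have hI' := hsurj (starRingEnd ℂ Complex.I) (by simp) (by simp) (by simp)
  obtain ⟨R, hR⟩ := exists_isResolvent hA Complex.I_re Complex.norm_I hI
  have hRc : IsCompactOperator R := by
    -- Formally `R* R = (A² + 1)⁻¹`, which has eigenvalue `(λ + 1)⁻¹` on `ψ`.
    refine isCompactOperator_of_eigenvectors R ψ (fun i => (lam i + 1)⁻¹) ?_ htot ?_
    · intro i v
      obtain ⟨x, hx, hxv⟩ := hR.2 v
      have hRψ : R (ψ i) = (lam i + 1 : ℂ)⁻¹ • (φ i + Complex.I • ψ i) := by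
        obtain ⟨w, hw, hw'⟩ := (mem_graph_iff _).1 (key Complex.I Complex.I_mul_I i)
        have h := hR.1 w
        rw [hw, hw', key2 _ Complex.I_mul_I, _root_.map_smul] at h
        replace h : (lam i + 1 : ℂ) • R (ψ i) = φ i + Complex.I • ψ i := h
        rw [← h, smul_smul, inv_mul_cancel₀ (hne i), one_smul]
      rw [hRψ, ← hx, inner_smul_right, ← hxv]
      push_cast
      congr 1
      have h := hA _ (T.closure.mem_graph x) _ (hle (hψ i))
      simp only at h
      rw [inner_add_right, inner_smul_right, inner_sub_left, inner_smul_left, h]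
      simp
    · intro ε hε
      refine (hfin ε⁻¹).subset fun i hi => ?_
      have h1 : 0 < lam i + 1 := by linarith [hlam i]
      have h2 : ε ≤ (lam i + 1)⁻¹ := by
        have : ε ≤ |(lam i + 1)⁻¹| := hi
        rwa [abs_of_pos (inv_pos.2 h1)] at this
      have h3 := (le_inv_comm₀ hε h1).1 h2
      show lam i ≤ ε⁻¹
      linarith
  refine ⟨hA.isSelfAdjoint hdA hI hI', ⟨⟨_, R, hR⟩, fun z S hS => hR.isCompactOperator hRc hS⟩,
    hA.kernel_eq_span ψ φ lam (fun i => hle (hψ i)) (fun i => hle (hφ i)) htot ?_⟩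
  exact (hfin 0).subset fun i hi => le_of_eq hi

end Abstract

/-! ### Gaussians as Schwartz functions, and their totality in `L²` -/

section Gaussian

open MeasureTheory Function
open scoped SchwartzMap FourierTransform ContDiff

universe u

theorem _root_.Function.HasTemperateGrowth.fderiv_right {E F : Type*} [NormedAddCommGroup E]
    [NormedSpace ℝ E] [NormedAddCommGroup F] [NormedSpace ℝ F] {p : E → F}
    (hp : p.HasTemperateGrowth) : (fderiv ℝ p).HasTemperateGrowth := by
  refine ⟨hp.1.fderiv_right (by simp), fun n => ?_⟩
  obtain ⟨k, C, h⟩ := hp.2 (n + 1)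
  exact ⟨k, C, fun x => by rw [norm_iteratedFDeriv_fderiv]; exact h x⟩

theorem pow_mul_exp_neg_sq_le (N : ℕ) {t : ℝ} (ht : 0 ≤ t) :
    (1 + t) ^ N * Real.exp (-Real.pi * t ^ 2) ≤ N.factorial * Real.exp 2 := by
  have h1 : (1 + t) ^ N ≤ N.factorial * Real.exp (1 + t) := by
    have h := Real.pow_div_factorial_le_exp (1 + t) (by positivity) N
    rwa [div_le_iff₀ (by positivity), mul_comm] at h
  calc (1 + t) ^ N * Real.exp (-Real.pi * t ^ 2)
      ≤ N.factorial * Real.exp (1 + t) * Real.exp (-Real.pi * t ^ 2) := by gcongr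
    _ = N.factorial * Real.exp (1 + t + -Real.pi * t ^ 2) := by rw [mul_assoc, ← Real.exp_add]
    _ ≤ N.factorial * Real.exp 2 := by
        gcongr
        -- From `t ≤ t² + 1/4` and `π > 3` the exponent is at most `5/4`.
        nlinarith [Real.pi_gt_three, sq_nonneg (t - 1 / 2)]

section Decay

variable {E : Type u} [NormedAddCommGroup E] [InnerProductSpace ℝ E]

theorem hasFDerivAt_exp_neg_norm_sq (x : E) :
    HasFDerivAt (fun x : E => Real.exp (-Real.pi * ‖x‖ ^ 2))
      (Real.exp (-Real.pi * ‖x‖ ^ 2) • (-2 * Real.pi) • innerSL ℝ x) x := by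
  have h := ((hasStrictFDerivAt_norm_sq x).hasFDerivAt.const_mul (-Real.pi)).exp
  convert h using 2
  ext y
  simp
  ring

theorem contDiff_exp_neg_norm_sq : ContDiff ℝ ∞ fun x : E => Real.exp (-Real.pi * ‖x‖ ^ 2) :=
  Real.contDiff_exp.comp (contDiff_const.mul (contDiff_norm_sq ℝ))

/-- Differentiating `e^{-π|x|²} p` gives `e^{-π|x|²} q` with `q = Dp - 2π ⟪x, ·⟫ p` again of
temperate growth. The codomain changes to `E →L[ℝ] F` at each order, so the induction quantifies
over `F`, and `E` and `F` share a universe. -/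
theorem decay_gaussian_smul (n : ℕ) : ∀ (F : Type u) [NormedAddCommGroup F] [NormedSpace ℝ F]
    (p : E → F), p.HasTemperateGrowth → ∀ k : ℕ, ∃ C, ∀ x,
      ‖x‖ ^ k * ‖iteratedFDeriv ℝ n (fun x => Real.exp (-Real.pi * ‖x‖ ^ 2) • p x) x‖ ≤ C := by
  induction n with
  | zero =>
    intro F _ _ p hp k
    obtain ⟨m, C, h⟩ := hp.2 0
    refine ⟨C * ((k + m).factorial * Real.exp 2), fun x => ?_⟩
    have hx := h x
    rw [norm_iteratedFDeriv_zero] at hx ⊢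
    have hC : 0 ≤ C := by
      by_contra hC
      have := (norm_nonneg _).trans hx
      exact absurd this (not_le.2 (mul_neg_of_neg_of_pos (not_le.1 hC) (by positivity)))
    rw [norm_smul, Real.norm_of_nonneg (Real.exp_pos _).le]
    calc ‖x‖ ^ k * (Real.exp (-Real.pi * ‖x‖ ^ 2) * ‖p x‖)
        ≤ (1 + ‖x‖) ^ k * (Real.exp (-Real.pi * ‖x‖ ^ 2) * (C * (1 + ‖x‖) ^ m)) := by
          gcongr; linarith
      _ = C * ((1 + ‖x‖) ^ (k + m) * Real.exp (-Real.pi * ‖x‖ ^ 2)) := by ring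
      _ ≤ _ := mul_le_mul_of_nonneg_left (pow_mul_exp_neg_sq_le _ (norm_nonneg x)) hC
  | succ n ih =>
    intro F _ _ p hp k
    have hpd : Differentiable ℝ p := hp.1.differentiable (by simp)
    let q : E → E →L[ℝ] F := fun x =>
      fderiv ℝ p x + (-2 * Real.pi) • ContinuousLinearMap.smulRightL ℝ E F (innerSL ℝ x) (p x)
    have hq : q.HasTemperateGrowth := by
      refine hp.fderiv_right.add (g := fun x => (-2 * Real.pi) •
        ContinuousLinearMap.smulRightL ℝ E F (innerSL ℝ x) (p x)) ?_
      refine HasTemperateGrowth.smul (f := fun _ => -2 * Real.pi) (.const _) ?_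
      exact (ContinuousLinearMap.smulRightL ℝ E F).bilinear_hasTemperateGrowth
        (innerSL ℝ).hasTemperateGrowth hp
    obtain ⟨C, hC⟩ := ih _ q hq k
    refine ⟨C, fun x => ?_⟩
    have hfd : fderiv ℝ (fun x => Real.exp (-Real.pi * ‖x‖ ^ 2) • p x) =
        fun x => Real.exp (-Real.pi * ‖x‖ ^ 2) • q x := by
      ext1 x
      refine ((hasFDerivAt_exp_neg_norm_sq x).fun_smul (hpd x).hasFDerivAt).fderiv.trans ?_
      ext y
      show Real.exp (-Real.pi * ‖x‖ ^ 2) • fderiv ℝ p x y +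
          (Real.exp (-Real.pi * ‖x‖ ^ 2) * ((-2 * Real.pi) * inner ℝ x y)) • p x =
        Real.exp (-Real.pi * ‖x‖ ^ 2) • (fderiv ℝ p x y + (-2 * Real.pi) • inner ℝ x y • p x)
      rw [smul_add, smul_smul, smul_smul, mul_assoc, mul_assoc, mul_assoc]
    rw [← norm_iteratedFDeriv_fderiv, hfd]
    exact hC x

/-- The Gaussian `y ↦ e^{-π|y|²} s`, as a Schwartz function. -/
noncomputable def gaussian {V : Type u} [NormedAddCommGroup V] [NormedSpace ℝ V] (s : V) :
    𝓢(E, V) where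
  toFun y := Real.exp (-Real.pi * ‖y‖ ^ 2) • s
  smooth' := contDiff_exp_neg_norm_sq.smul contDiff_const
  decay' k n := decay_gaussian_smul n V (fun _ => s) (.const s) k

theorem gaussian_apply {V : Type u} [NormedAddCommGroup V] [NormedSpace ℝ V] (s : V) (y : E) :
    gaussian s y = Real.exp (-Real.pi * ‖y‖ ^ 2) • s := rfl

end Decay

section Density

variable {E : Type*} [NormedAddCommGroup E] [InnerProductSpace ℝ E] [FiniteDimensional ℝ E]
  [MeasurableSpace E] [BorelSpace E]

/-- Completing the square, `2c‖y‖ ≤ c²/π + π‖y‖²`, so the square of the function is at most a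
constant times `e^{-π‖y‖²}`. -/
theorem memLp_exp_sub_norm_sq (c : ℝ) :
    MemLp (fun y : E => Real.exp (c * ‖y‖ - Real.pi * ‖y‖ ^ 2)) 2 volume := by
  rw [memLp_two_iff_integrable_sq (by fun_prop)]
  have h1 : Integrable fun y : E => Real.exp (c ^ 2 / Real.pi) * Real.exp (-Real.pi * ‖y‖ ^ 2) := by
    refine Integrable.const_mul ?_ _
    have h := (GaussianFourier.integrable_cexp_neg_mul_sq_norm_add (b := Real.pi)
      (by simpa using Real.pi_pos) 0 (0 : E)).re
    refine h.congr (Filter.Eventually.of_forall fun y => ?_)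
    simp only [inner_zero_left, Complex.ofReal_zero, mul_zero, add_zero]
    rw [← Complex.ofReal_re (Real.exp _)]
    push_cast
    rfl
  refine h1.mono' (by fun_prop) (Filter.Eventually.of_forall fun y => ?_)
  rw [Real.norm_of_nonneg (by positivity), ← Real.exp_nat_mul, ← Real.exp_add]
  refine Real.exp_le_exp.2 ?_
  have h2 : 0 ≤ (c / Real.pi - ‖y‖) ^ 2 * Real.pi := by positivity
  have h3 : (c / Real.pi - ‖y‖) ^ 2 * Real.pi
      = c ^ 2 / Real.pi - 2 * c * ‖y‖ + Real.pi * ‖y‖ ^ 2 := by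
    field_simp
    ring
  push_cast
  linarith

variable {V : Type*} [NormedAddCommGroup V] [NormedSpace ℂ V]

/-- The Gaussian absorbs any exponential factor and Hölder does the rest. These exponential moments
dominate the power series of the Fourier character. -/
theorem integrable_exp_smul (f : Lp V 2 (volume : Measure E)) (c : ℝ) :
    Integrable fun y => Real.exp (c * ‖y‖) • Real.exp (-Real.pi * ‖y‖ ^ 2) • f y := by
  have h : MemLp (fun y => Real.exp (c * ‖y‖ - Real.pi * ‖y‖ ^ 2) • f y) 1 volume :=
    (Lp.memLp f).smul (𝕜 := ℝ) (memLp_exp_sub_norm_sq c)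
  refine (memLp_one_iff_integrable.1 h).congr (Filter.Eventually.of_forall fun y => ?_)
  simp only
  rw [smul_smul, ← Real.exp_add]
  congr 2
  ring

variable [CompleteSpace V]

/-- Polynomials times the Gaussian are total in `L²`. -/
theorem eq_zero_of_integral_gaussian (f : Lp V 2 (volume : Measure E))
    (h : ∀ (ξ : E) (k : ℕ),
      ∫ y, ((inner ℝ ξ y : ℝ) ^ k * Real.exp (-Real.pi * ‖y‖ ^ 2)) • f y = 0) : f = 0 := by
  set G : E → V := fun y => Real.exp (-Real.pi * ‖y‖ ^ 2) • f y with hG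
  have hGi : Integrable G := by
    have h1 := integrable_exp_smul f 0
    simpa only [zero_mul, Real.exp_zero, one_smul] using h1
  have hF : 𝓕 G = 0 := by
    ext ξ
    rw [Real.fourier_eq']
    -- Expand the character in its power series and integrate termwise: each term is a multiple of a
    -- moment that vanishes by hypothesis. The dominating series sums to `e^{2π‖ξ‖‖y‖} ‖G y‖`.
    have hs : HasSum (fun k : ℕ => ∫ y, ((k.factorial : ℂ)⁻¹ *
        (-2 * Real.pi * Complex.I * (inner ℝ y ξ : ℝ)) ^ k) • G y)
        (∫ y, Complex.exp (((-2 * Real.pi * inner ℝ y ξ : ℝ) : ℂ) * Complex.I) • G y) := by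
      refine hasSum_integral_of_dominated_convergence
        (fun (k : ℕ) y => (2 * Real.pi * ‖ξ‖ * ‖y‖) ^ k / k.factorial * ‖G y‖) ?_ ?_ ?_ ?_ ?_
      · intro k
        exact AEStronglyMeasurable.smul (by fun_prop) hGi.1
      · intro k
        refine Filter.Eventually.of_forall fun y => ?_
        rw [norm_smul, norm_mul, norm_pow, norm_inv]
        simp only [norm_mul, norm_neg, Complex.norm_natCast, Complex.norm_I, mul_one,
          Complex.norm_real, Complex.norm_ofNat, Real.norm_of_nonneg Real.pi_pos.le]
        have hb : 2 * Real.pi * ‖(inner ℝ y ξ : ℝ)‖ ≤ 2 * Real.pi * ‖ξ‖ * ‖y‖ := by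
          rw [mul_assoc (2 * Real.pi), mul_comm ‖ξ‖]
          exact mul_le_mul_of_nonneg_left (norm_inner_le_norm y ξ) (by positivity)
        rw [div_eq_inv_mul]
        exact mul_le_mul_of_nonneg_right (mul_le_mul_of_nonneg_left
          (pow_le_pow_left₀ (by positivity) hb k) (by positivity)) (norm_nonneg _)
      · exact Filter.Eventually.of_forall fun y =>
          (Real.summable_pow_div_factorial _).mul_right _
      · have h1 := (integrable_exp_smul f (2 * Real.pi * ‖ξ‖)).norm
        refine h1.congr (Filter.Eventually.of_forall fun y => ?_)
        simp only
        rw [tsum_mul_right, norm_smul, Real.norm_of_nonneg (Real.exp_pos _).le,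
          (show Real.exp (2 * Real.pi * ‖ξ‖ * ‖y‖) = _ from
            (congrFun Real.exp_eq_exp_ℝ _).trans (congrFun NormedSpace.exp_eq_tsum_div _))]
      · refine Filter.Eventually.of_forall fun y => ?_
        refine HasSum.smul_const ?_ _
        have h1 := NormedSpace.expSeries_div_hasSum_exp
          (((-2 * Real.pi * inner ℝ y ξ : ℝ) : ℂ) * Complex.I)
        rw [← Complex.exp_eq_exp_ℂ] at h1
        refine h1.congr_fun fun k => ?_
        rw [div_eq_inv_mul]
        congr 2
        push_cast
        ring
    have hz : ∀ k : ℕ, ∫ y, ((k.factorial : ℂ)⁻¹ *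
        (-2 * Real.pi * Complex.I * (inner ℝ y ξ : ℝ)) ^ k) • G y = 0 := by
      intro k
      have h1 := congrArg (fun v => ((k.factorial : ℂ)⁻¹ *
        (-2 * Real.pi * Complex.I) ^ k) • v) (h ξ k)
      simp only [smul_zero] at h1
      rw [← h1, ← integral_smul]
      refine integral_congr_ae (Filter.Eventually.of_forall fun y => ?_)
      simp only [hG]
      rw [← Complex.coe_smul, ← Complex.coe_smul, smul_smul, smul_smul, real_inner_comm]
      congr 1
      push_cast
      ring
    simp only [hz] at hs
    exact hs.unique hasSum_zero
  -- Injectivity of the Fourier transform on `L¹` by duality: a test function `g` is `𝓕 (𝓕⁻ g)`, and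
  -- moving `𝓕` onto `G` gives `∫ g G = ∫ (𝓕⁻ g) (𝓕 G) = 0`.
  have hG0 : ∀ᵐ y, G y = 0 := by
    refine ae_eq_zero_of_integral_contDiff_smul_eq_zero hGi.locallyIntegrable fun g hg hgc => ?_
    have hgc' : HasCompactSupport fun y => (g y : ℂ) := hgc.comp_left Complex.ofReal_zero
    let φ : 𝓢(E, ℂ) := hgc'.toSchwartzMap (Complex.ofRealCLM.contDiff.comp hg)
    have hφ : ∀ y, 𝓕 ((𝓕⁻ φ : 𝓢(E, ℂ)) : E → ℂ) y = g y := by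
      intro y
      rw [← SchwartzMap.fourier_coe, FourierTransform.fourier_fourierInv_eq]
      rfl
    have h1 := VectorFourier.integral_fourierIntegral_smul_eq_flip (L := innerₗ E)
      Real.continuous_fourierChar continuous_inner (𝓕⁻ φ : 𝓢(E, ℂ)).integrable hGi
      (μ := volume) (ν := volume)
    have h2 : VectorFourier.fourierIntegral Real.fourierChar volume (innerₗ E).flip G = 0 := by
      rw [flip_innerₗ]
      exact hF
    rw [h2] at h1
    simp only [Pi.zero_apply, smul_zero, integral_zero] at h1
    rw [← h1]
    refine integral_congr_ae (Filter.Eventually.of_forall fun y => ?_)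
    show g y • G y = 𝓕 ((𝓕⁻ φ : 𝓢(E, ℂ)) : E → ℂ) y • G y
    rw [hφ, Complex.coe_smul]
  rw [Lp.eq_zero_iff_ae_eq_zero]
  filter_upwards [hG0] with y hy
  exact (smul_eq_zero.1 hy).resolve_left (Real.exp_pos _).ne'

end Density

end Gaussian

/-! ### The algebra of bosonic and fermionic ladder operators -/

section Oscillator

variable {A : Type*} [Ring A] [Algebra ℂ A] {n : ℕ}

/-- Canonical commutation relations for `a, a'`, canonical anticommutation relations for `c, d`,
and mutual commutation. -/
structure OscillatorRel (κ : ℂ) (a a' c d : Fin n → A) : Prop where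
  aa : ∀ i j, a i * a j = a j * a i
  aa'' : ∀ i j, a' i * a' j = a' j * a' i
  aa' : ∀ i j, a i * a' j = a' j * a i + if i = j then κ • 1 else 0
  cc : ∀ i j, c i * c j = -(c j * c i)
  dd : ∀ i j, d i * d j = -(d j * d i)
  cd : ∀ i j, c i * d j = (if i = j then 1 else 0) - d j * c i
  ac : ∀ i j, a i * c j = c j * a i
  ad : ∀ i j, a i * d j = d j * a i
  a'c : ∀ i j, a' i * c j = c j * a' i
  a'd : ∀ i j, a' i * d j = d j * a' i

variable {κ : ℂ} {a a' c d : Fin n → A}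

/-- Exchanging `i` and `j` changes the sign of the `x` factor only, so the sum is its own negative.
-/
theorem sum_sum_eq_zero_of_anticomm {x y : Fin n → A} (hx : ∀ i j, x i * x j = -(x j * x i))
    (hy : ∀ i j, y i * y j = y j * y i) : ∑ i, ∑ j, x i * x j * (y i * y j) = 0 := by
  have h : ∑ i, ∑ j, x i * x j * (y i * y j) = -∑ i, ∑ j, x i * x j * (y i * y j) := by
    conv_lhs => rw [Finset.sum_comm]
    rw [← Finset.sum_neg_distrib]
    refine Finset.sum_congr rfl fun i _ => ?_
    rw [← Finset.sum_neg_distrib]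
    refine Finset.sum_congr rfl fun j _ => ?_
    rw [hx, hy j i, neg_mul]
  have h2 : (2 : ℂ) • ∑ i, ∑ j, x i * x j * (y i * y j) = 0 := by
    rw [two_smul]
    nth_rewrite 1 [h]
    exact neg_add_cancel _
  exact (smul_eq_zero.1 h2).resolve_left two_ne_zero

theorem OscillatorRel.sq (h : OscillatorRel κ a a' c d) :
    (∑ j, (c j * a j + d j * a' j)) * ∑ j, (c j * a j + d j * a' j) =
      ∑ j, a' j * a j + κ • ∑ j, c j * d j := by
  have e : ∀ i j, (c i * a i + d i * a' i) * (c j * a j + d j * a' j) =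
      c i * c j * (a i * a j) + d i * d j * (a' i * a' j)
        + (c i * d j * (a i * a' j) + d i * c j * (a' i * a j)) := by
    intro i j
    have e1 : c i * a i * (c j * a j) = c i * c j * (a i * a j) := by
      rw [mul_assoc, ← mul_assoc (a i), h.ac]; noncomm_ring
    have e2 : d i * a' i * (d j * a' j) = d i * d j * (a' i * a' j) := by
      rw [mul_assoc, ← mul_assoc (a' i), h.a'd]; noncomm_ring
    have e3 : c i * a i * (d j * a' j) = c i * d j * (a i * a' j) := by
      rw [mul_assoc, ← mul_assoc (a i), h.ad]; noncomm_ring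
    have e4 : d i * a' i * (c j * a j) = d i * c j * (a' i * a j) := by
      rw [mul_assoc, ← mul_assoc (a' i), h.a'c]; noncomm_ring
    rw [mul_add, add_mul, add_mul, e1, e2, e3, e4]
    abel
  rw [Finset.sum_mul_sum]
  simp only [e, Finset.sum_add_distrib]
  -- The `cc` and `dd` sums vanish. Swapping the indices in one mixed sum pairs `c_i d_j a_i a'_j`
  -- with `d_j c_i a'_j a_i`: these cancel for `i ≠ j` and leave `a'_i a_i + κ c_i d_i` for `i = j`.
  rw [sum_sum_eq_zero_of_anticomm h.cc h.aa, sum_sum_eq_zero_of_anticomm h.dd h.aa'', add_zero,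
    zero_add, Finset.sum_comm (f := fun i j => d i * c j * (a' i * a j)), ← Finset.sum_add_distrib,
    Finset.smul_sum, ← Finset.sum_add_distrib]
  refine Finset.sum_congr rfl fun i _ => ?_
  rw [← Finset.sum_add_distrib, Finset.sum_eq_single i]
  · rw [h.aa']
    have h1 := h.cd i i
    simp only [if_true] at h1 ⊢
    rw [mul_add, mul_smul_comm, mul_one, add_right_comm, ← add_mul, h1, sub_add_cancel, one_mul]
  · intro j _ hj
    have h1 := h.cd i j
    rw [if_neg hj.symm, zero_sub] at h1
    rw [h.aa', if_neg hj.symm, h1, add_zero, neg_mul, neg_add_cancel]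
  · simp

theorem OscillatorRel.number_mul (h : OscillatorRel κ a a' c d) (j : Fin n) :
    (∑ i, a' i * a i) * a' j = a' j * ∑ i, a' i * a i + κ • a' j := by
  rw [Finset.sum_mul, Finset.mul_sum]
  have e : ∀ i, a' i * a i * a' j = a' j * (a' i * a i) + if i = j then κ • a' j else 0 := by
    intro i
    rw [mul_assoc, h.aa', mul_add, ← mul_assoc, ← mul_assoc, h.aa'' i j]
    split_ifs with hij
    · rw [mul_smul_comm, mul_one, hij]
    · rw [mul_zero]
  simp only [e, Finset.sum_add_distrib, Finset.sum_ite_eq', Finset.mem_univ, if_true]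

end Oscillator

/-! ### Fock vectors and their eigenvalues -/

section Fock

variable {M : Type*} [AddCommGroup M] [Module ℂ M] {n : ℕ} {κ : ℂ}
  {a a' c d : Fin n → Module.End ℂ M}

/-- The vector obtained by applying a word of creation operators. -/
def fockVec (a' : Fin n → Module.End ℂ M) (v : M) (u : List (Fin n)) : M :=
  (u.map a').prod v

theorem fockVec_nil (v : M) : fockVec a' v [] = v := by simp [fockVec]

theorem fockVec_cons (v : M) (j : Fin n) (u : List (Fin n)) :
    fockVec a' v (j :: u) = a' j (fockVec a' v u) := by simp [fockVec]

theorem OscillatorRel.number_fockVec (h : OscillatorRel κ a a' c d) {v : M}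
    (hv : ∀ j, a j v = 0) (u : List (Fin n)) :
    (∑ i, a' i * a i) (fockVec a' v u) = (κ * u.length) • fockVec a' v u := by
  induction u with
  | nil => simp [fockVec_nil, hv, LinearMap.sum_apply]
  | cons j u ih =>
    have h1 := congrArg (fun f => f (fockVec a' v u)) (h.number_mul j)
    simp only [Module.End.mul_apply, LinearMap.add_apply, LinearMap.smul_apply, ih,
      map_smul] at h1
    rw [fockVec_cons, h1, List.length_cons]
    push_cast
    module

theorem OscillatorRel.fermion_fockVec (h : OscillatorRel κ a a' c d) {v : M} {μ : ℂ}
    (hv : (∑ i, c i * d i) v = μ • v) (u : List (Fin n)) :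
    (∑ i, c i * d i) (fockVec a' v u) = μ • fockVec a' v u := by
  induction u with
  | nil => rw [fockVec_nil, hv]
  | cons j u ih =>
    have hc : (∑ i, c i * d i) * a' j = a' j * ∑ i, c i * d i := by
      rw [Finset.sum_mul, Finset.mul_sum]
      refine Finset.sum_congr rfl fun i _ => ?_
      rw [mul_assoc, ← h.a'd, ← mul_assoc, ← h.a'c, mul_assoc]
    have h1 := congrArg (fun f => f (fockVec a' v u)) hc
    simp only [Module.End.mul_apply, ih, map_smul] at h1
    rw [fockVec_cons, h1]

theorem OscillatorRel.sq_fockVec (h : OscillatorRel κ a a' c d) {v : M} {μ : ℂ}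
    (hv : ∀ j, a j v = 0) (hμ : (∑ i, c i * d i) v = μ • v) (u : List (Fin n)) :
    (∑ j, (c j * a j + d j * a' j)) ((∑ j, (c j * a j + d j * a' j)) (fockVec a' v u)) =
      (κ * (u.length + μ)) • fockVec a' v u := by
  rw [← Module.End.mul_apply, h.sq, LinearMap.add_apply, LinearMap.smul_apply,
    h.number_fockVec hv, h.fermion_fockVec hμ]
  module

theorem create_mem {v : M} (j : Fin n) {x : M}
    (hx : x ∈ Submodule.span ℂ (Set.range (fockVec a' v))) :
    a' j x ∈ Submodule.span ℂ (Set.range (fockVec a' v)) := by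
  induction hx using Submodule.span_induction with
  | mem x hx =>
    obtain ⟨u, rfl⟩ := hx
    exact Submodule.subset_span ⟨j :: u, fockVec_cons v j u⟩
  | zero => simp
  | add x y _ _ hx hy => rw [map_add]; exact add_mem hx hy
  | smul c x _ hx => rw [map_smul]; exact Submodule.smul_mem _ _ hx

/-- Commuting an annihilator through a word costs only shorter words, until it reaches the vacuum
and kills it. -/
theorem OscillatorRel.annihilate_mem (h : OscillatorRel κ a a' c d) {v : M}
    (hv : ∀ j, a j v = 0) (j : Fin n) {x : M}
    (hx : x ∈ Submodule.span ℂ (Set.range (fockVec a' v))) :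
    a j x ∈ Submodule.span ℂ (Set.range (fockVec a' v)) := by
  induction hx using Submodule.span_induction with
  | mem x hx =>
    obtain ⟨u, rfl⟩ := hx
    induction u with
    | nil => rw [fockVec_nil, hv]; exact zero_mem _
    | cons i u ih =>
      rw [fockVec_cons, ← Module.End.mul_apply, h.aa', LinearMap.add_apply]
      refine add_mem (create_mem i ih) ?_
      split_ifs
      · exact Submodule.smul_mem _ _ (Submodule.subset_span ⟨u, rfl⟩)
      · exact zero_mem _
  | zero => simp
  | add x y _ _ hx hy => rw [map_add]; exact add_mem hx hy
  | smul c x _ hx => rw [map_smul]; exact Submodule.smul_mem _ _ hx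

end Fock

/-! ### Fermionic ladder elements in the Clifford algebra -/

section Fermion

variable {A : Type*} [Ring A] [Algebra ℂ A] [StarRing A] {n : ℕ}

/-- The element `½ (ε^j - i e_j)`. -/
noncomputable def lower (E F : Fin n → A) (j : Fin n) : A :=
  (1 / 2 : ℂ) • (F j - Complex.I • E j)

/-- The element `-½ (ε^j + i e_j)`. -/
noncomputable def raise (E F : Fin n → A) (j : Fin n) : A :=
  (-1 / 2 : ℂ) • (F j + Complex.I • E j)

variable {E F : Fin n → A}

/-- One computation covers all the anticommutators: `1 + st` vanishes for `s = t = ±i` and equals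
`2` for `s = -i`, `t = i`. -/
theorem CliffordRel.anticomm_add (h : CliffordRel E F) (i j : Fin n) (s t : ℂ) :
    (F i + s • E i) * (F j + t • E j) + (F j + t • E j) * (F i + s • E i) =
      if i = j then (-2 * (1 + s * t)) • 1 else 0 := by
  have e : (F i + s • E i) * (F j + t • E j) + (F j + t • E j) * (F i + s • E i) =
      (F i * F j + F j * F i) + (s * t) • (E i * E j + E j * E i) +
      t • (F i * E j + E j * F i) + s • (E i * F j + F j * E i) := by
    simp only [mul_add, add_mul, smul_mul_assoc, mul_smul_comm, smul_add, smul_smul]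
    rw [mul_comm t s]
    abel
  rw [e, h.EF i j, h.EF j i]
  split_ifs with hij
  · subst hij
    rw [h.E_sq, h.F_sq]
    simp only [add_neg_cancel, neg_add_cancel, smul_zero, add_zero]
    module
  · rw [h.EE i j hij, h.FF i j hij]
    simp

theorem CliffordRel.lower_lower (h : CliffordRel E F) (i j : Fin n) :
    lower E F i * lower E F j = -(lower E F j * lower E F i) := by
  have h1 := h.anticomm_add i j (-Complex.I) (-Complex.I)
  rw [neg_mul_neg, Complex.I_mul_I] at h1
  simp only [add_neg_cancel, mul_zero, zero_smul, ite_self, neg_smul, ← sub_eq_add_neg] at h1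
  simp only [lower, smul_mul_assoc, mul_smul_comm]
  rw [eq_neg_of_add_eq_zero_left h1]
  simp

theorem CliffordRel.raise_raise (h : CliffordRel E F) (i j : Fin n) :
    raise E F i * raise E F j = -(raise E F j * raise E F i) := by
  have h1 := h.anticomm_add i j Complex.I Complex.I
  rw [Complex.I_mul_I] at h1
  simp only [add_neg_cancel, mul_zero, zero_smul, ite_self] at h1
  simp only [raise, smul_mul_assoc, mul_smul_comm]
  rw [eq_neg_of_add_eq_zero_left h1]
  simp

theorem CliffordRel.lower_raise (h : CliffordRel E F) (i j : Fin n) :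
    lower E F i * raise E F j = (if i = j then 1 else 0) - raise E F j * lower E F i := by
  have h1 := h.anticomm_add i j (-Complex.I) Complex.I
  rw [neg_mul Complex.I, Complex.I_mul_I] at h1
  simp only [neg_smul, ← sub_eq_add_neg] at h1
  simp only [lower, raise, smul_mul_assoc, mul_smul_comm]
  rw [eq_sub_of_add_eq h1]
  split_ifs <;> module

/-- This identifies `∑ c_j d_j` with a sum of projections, whose common kernel is the range of left
multiplication by `P`. -/
theorem CliffordRel.lower_mul_raise_self (h : CliffordRel E F) (j : Fin n) :
    lower E F j * raise E F j = 1 - halfProj E F j := by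
  have e : (F j - Complex.I • E j) * (F j + Complex.I • E j) =
      F j * F j + Complex.I • (F j * E j) - Complex.I • (E j * F j)
        - (Complex.I * Complex.I) • (E j * E j) := by
    simp only [mul_add, sub_mul, smul_mul_assoc, mul_smul_comm]
    module
  simp only [lower, raise, halfProj, smul_mul_assoc, mul_smul_comm]
  rw [e, h.E_sq, h.F_sq, Complex.I_mul_I, eq_neg_iff_add_eq_zero.1 (h.EF j j) |>
    eq_neg_of_add_eq_zero_right]
  module

theorem CliffordRel.raise_mul_vacuum [StarModule ℂ A] (h : CliffordRel E F) (j : Fin n) :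
    raise E F j * vacuumProj E F = 0 := by
  rw [raise, smul_mul_assoc, add_mul, h.F_mul_vacuum, smul_mul_assoc, neg_add_cancel, smul_zero]

theorem vacuumProj_mul_eq_self [StarModule ℂ A] {x : A} (hx : ∀ j, halfProj E F j * x = x) :
    vacuumProj E F * x = x := by
  have key : ∀ l : List (Fin n), partProj E F l * x = x := by
    intro l
    induction l with
    | nil => simp [partProj]
    | cons i l ih =>
      have : partProj E F (i :: l) = halfProj E F i * partProj E F l := by simp [partProj]
      rw [this, mul_assoc, ih, hx]
  rw [vacuumProj_eq]
  exact key _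

end Fermion

/-! ### Ladder operators on Schwartz functions -/

section SchwartzOperators

open MeasureTheory SchwartzMap LineDeriv

universe u

variable {E V : Type u} [NormedAddCommGroup E] [InnerProductSpace ℝ E] [NormedAddCommGroup V]
  [InnerProductSpace ℂ V]

/-- The directional derivative on Schwartz functions. -/
noncomputable def partialOp (v : E) : Module.End ℂ 𝓢(E, V) :=
  (lineDerivOpCLM ℂ 𝓢(E, V) v).toLinearMap

/-- Multiplication by the coordinate `⟪v, y⟫` on Schwartz functions. -/
noncomputable def coordOp (v : E) : Module.End ℂ 𝓢(E, V) :=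
  (smulLeftCLM V fun y : E => ((inner ℝ v y : ℝ) : ℂ)).toLinearMap

/-- A pointwise linear operator on Schwartz functions. -/
noncomputable def pointwiseOp (L : V →L[ℂ] V) : Module.End ℂ 𝓢(E, V) :=
  (postcompCLM L).toLinearMap

theorem partialOp_apply (v : E) (f : 𝓢(E, V)) (y : E) : partialOp v f y = fderiv ℝ f y v := rfl

theorem hasTemperateGrowth_coord (v : E) :
    (fun y : E => ((inner ℝ v y : ℝ) : ℂ)).HasTemperateGrowth := by
  fun_prop

theorem coordOp_apply (v : E) (f : 𝓢(E, V)) (y : E) :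
    coordOp v f y = ((inner ℝ v y : ℝ) : ℂ) • f y :=
  smulLeftCLM_apply_apply (hasTemperateGrowth_coord v) f y

theorem pointwiseOp_apply (L : V →L[ℂ] V) (f : 𝓢(E, V)) (y : E) : pointwiseOp L f y = L (f y) :=
  rfl

theorem partialOp_comm (v w : E) :
    (partialOp v * partialOp w : Module.End ℂ 𝓢(E, V)) = partialOp w * partialOp v := by
  have h : ∀ (v w : E) (f : 𝓢(E, V)) (y : E),
      partialOp v (partialOp w f) y = fderiv ℝ (fderiv ℝ f) y v w := by
    intro v w f y
    rw [partialOp_apply]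
    have h1 : HasFDerivAt (fderiv ℝ f) (fderiv ℝ (fderiv ℝ f) y) y :=
      (((f.smooth 2).fderiv_right (m := 1) (by norm_num)).differentiable (by simp) y).hasFDerivAt
    have h2 := h1.clm_apply (hasFDerivAt_const w y)
    have h3 : (partialOp w f : E → V) = fun y => fderiv ℝ f y w := rfl
    rw [h3, h2.fderiv]
    simp
  ext f y
  show partialOp v (partialOp w f) y = partialOp w (partialOp v f) y
  rw [h, h]
  exact ((f.smooth 2).contDiffAt.isSymmSndFDerivAt (by simp)) v w

theorem coordOp_comm (v w : E) :
    (coordOp v * coordOp w : Module.End ℂ 𝓢(E, V)) = coordOp w * coordOp v := by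
  ext f y
  show coordOp v (coordOp w f) y = coordOp w (coordOp v f) y
  simp only [coordOp_apply, smul_smul]
  rw [mul_comm]

theorem partialOp_mul_coordOp (v w : E) :
    (partialOp v * coordOp w : Module.End ℂ 𝓢(E, V)) =
      coordOp w * partialOp v + ((inner ℝ w v : ℝ) : ℂ) • 1 := by
  ext f y
  show partialOp v (coordOp w f) y = coordOp w (partialOp v f) y + ((inner ℝ w v : ℝ) : ℂ) • f y
  rw [partialOp_apply, coordOp_apply, partialOp_apply]
  have h1 : (coordOp w f : E → V) = fun y => (inner ℝ w y : ℝ) • f y := by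
    ext y
    rw [coordOp_apply, Complex.coe_smul]
  have h2 := (innerSL ℝ w).hasFDerivAt (x := y) |>.fun_smul (f.hasFDerivAt y)
  simp only [innerSL_apply_apply] at h2
  rw [h1, h2.fderiv, Complex.coe_smul, Complex.coe_smul]
  rfl

theorem partialOp_mul_pointwiseOp (v : E) (L : V →L[ℂ] V) :
    partialOp v * pointwiseOp L = pointwiseOp L * partialOp v := by
  ext f y
  show fderiv ℝ (pointwiseOp L f) y v = L (fderiv ℝ f y v)
  have h2 := (L.restrictScalars ℝ).hasFDerivAt (x := f y) |>.comp y (f.hasFDerivAt y)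
  have h1 : (pointwiseOp L f : E → V) = L.restrictScalars ℝ ∘ f := rfl
  rw [h1, h2.fderiv]
  rfl

theorem coordOp_mul_pointwiseOp (v : E) (L : V →L[ℂ] V) :
    coordOp v * pointwiseOp L = pointwiseOp L * coordOp v := by
  ext f y
  show coordOp v (pointwiseOp L f) y = pointwiseOp L (coordOp v f) y
  simp only [coordOp_apply, pointwiseOp_apply, map_smul]

theorem coordOp_eq_sum {n : ℕ} (b : OrthonormalBasis (Fin n) ℝ E) (v : E) :
    (coordOp v : Module.End ℂ 𝓢(E, V)) = ∑ j, ((inner ℝ (b j) v : ℝ) : ℂ) • coordOp (b j) := by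
  ext f y
  rw [LinearMap.sum_apply, _root_.sum_apply, coordOp_apply]
  simp only [LinearMap.smul_apply, _root_.smul_apply, coordOp_apply, smul_smul]
  rw [← Finset.sum_smul, ← b.sum_inner_mul_inner]
  push_cast
  congr 1
  refine Finset.sum_congr rfl fun j _ => ?_
  rw [real_inner_comm v]

/-- The annihilation operator `∂_v + 2π ⟪v, y⟫`. -/
noncomputable def annihilate (v : E) : Module.End ℂ 𝓢(E, V) :=
  partialOp v + (2 * Real.pi : ℂ) • coordOp v

/-- The creation operator `-∂_v + 2π ⟪v, y⟫`. -/
noncomputable def create (v : E) : Module.End ℂ 𝓢(E, V) :=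
  -partialOp v + (2 * Real.pi : ℂ) • coordOp v

theorem annihilate_comm (v w : E) :
    (annihilate v * annihilate w : Module.End ℂ 𝓢(E, V)) = annihilate w * annihilate v := by
  simp only [annihilate, mul_add, add_mul, mul_smul_comm, smul_mul_assoc,
    partialOp_mul_coordOp, partialOp_comm v w, coordOp_comm v w, real_inner_comm w v]
  module

theorem create_comm (v w : E) :
    (create v * create w : Module.End ℂ 𝓢(E, V)) = create w * create v := by
  simp only [create, mul_add, add_mul, mul_smul_comm, smul_mul_assoc, neg_mul, mul_neg,
    partialOp_mul_coordOp, partialOp_comm v w, coordOp_comm v w, real_inner_comm w v]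
  module

theorem annihilate_mul_create (v w : E) :
    (annihilate v * create w : Module.End ℂ 𝓢(E, V)) =
      create w * annihilate v + (4 * Real.pi * (inner ℝ v w : ℝ) : ℂ) • 1 := by
  simp only [create, annihilate, mul_add, add_mul, mul_smul_comm, smul_mul_assoc, neg_mul, mul_neg,
    partialOp_mul_coordOp, partialOp_comm v w, coordOp_comm v w, real_inner_comm w v]
  module

theorem annihilate_mul_pointwiseOp (v : E) (L : V →L[ℂ] V) :
    annihilate v * pointwiseOp L = pointwiseOp L * annihilate v := by
  simp only [annihilate, mul_add, add_mul, mul_smul_comm, smul_mul_assoc,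
    partialOp_mul_pointwiseOp, coordOp_mul_pointwiseOp]

theorem create_mul_pointwiseOp (v : E) (L : V →L[ℂ] V) :
    create v * pointwiseOp L = pointwiseOp L * create v := by
  simp only [create, mul_add, add_mul, mul_smul_comm, smul_mul_assoc, neg_mul, mul_neg,
    partialOp_mul_pointwiseOp, coordOp_mul_pointwiseOp]

theorem annihilate_gaussian (v : E) (s : V) : annihilate v (gaussian s) = 0 := by
  ext y
  show partialOp v (gaussian s) y + (2 * Real.pi : ℂ) • coordOp v (gaussian s) y = 0
  have h1 : ((gaussian s : 𝓢(E, V)) : E → V) = fun y => Real.exp (-Real.pi * ‖y‖ ^ 2) • s := rfl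
  rw [coordOp_apply, partialOp_apply, h1,
    ((hasFDerivAt_exp_neg_norm_sq y).smul_const s).fderiv]
  show (Real.exp (-Real.pi * ‖y‖ ^ 2) * ((-2 * Real.pi) * inner ℝ y v)) • s + _ = 0
  simp only [← Complex.coe_smul, smul_smul]
  rw [← add_smul, real_inner_comm]
  push_cast
  convert zero_smul ℂ s using 2
  ring

theorem coordOp_pow_apply (ξ : E) (k : ℕ) (f : 𝓢(E, V)) (y : E) :
    (coordOp ξ ^ k) f y = (((inner ℝ ξ y : ℝ) ^ k : ℝ) : ℂ) • f y := by
  induction k with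
  | zero => simp
  | succ k ih =>
    rw [pow_succ', Module.End.mul_apply, coordOp_apply, ih, smul_smul]
    push_cast
    rw [pow_succ']

/-- Each coordinate is `(a_j + a'_j) / 4π`, and the span of the Fock vectors is stable under both
summands. This reduces totality of Fock vectors to totality of polynomials times the Gaussian. -/
theorem coordOp_pow_gaussian_mem {n : ℕ} {κ : ℂ} {c d : Fin n → Module.End ℂ 𝓢(E, V)}
    (b : OrthonormalBasis (Fin n) ℝ E)
    (h : OscillatorRel κ (fun j => annihilate (b j)) (fun j => create (b j)) c d) (s : V) (ξ : E)
    (k : ℕ) : (coordOp ξ ^ k) (gaussian s) ∈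
      Submodule.span ℂ (Set.range (fockVec (fun j => create (b j)) (gaussian s : 𝓢(E, V)))) := by
  induction k with
  | zero => exact Submodule.subset_span ⟨[], by simp [fockVec_nil]⟩
  | succ k ih =>
    rw [pow_succ', Module.End.mul_apply]
    nth_rewrite 1 [coordOp_eq_sum b]
    rw [LinearMap.sum_apply]
    refine sum_mem fun j _ => Submodule.smul_mem _ _ ?_
    have e : (coordOp (b j) : Module.End ℂ 𝓢(E, V)) =
        (4 * Real.pi : ℂ)⁻¹ • (annihilate (b j) + create (b j)) := by
      have h0 : (4 * Real.pi : ℂ) ≠ 0 := by simp [Real.pi_ne_zero]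
      rw [eq_inv_smul_iff₀ h0, annihilate, create]
      module
    rw [e, LinearMap.smul_apply, LinearMap.add_apply]
    exact Submodule.smul_mem _ _ (add_mem
      (h.annihilate_mem (fun j => annihilate_gaussian (b j) s) j ih) (create_mem j ih))

section L2

variable [FiniteDimensional ℝ E] [MeasurableSpace E] [BorelSpace E]

/-- The class of a Schwartz function in `L²`. -/
noncomputable abbrev toL2 (f : 𝓢(E, V)) : Lp V 2 (volume : Measure E) := f.toLp 2 volume

theorem inner_toL2 (f g : 𝓢(E, V)) :
    inner ℂ (toL2 f) (toL2 g) = ∫ y, inner ℂ (f y) (g y) :=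
  inner_toL2_toL2_eq f g volume

/-- Integration by parts, without boundary terms for Schwartz functions. -/
theorem inner_partialOp_left (v : E) (f g : 𝓢(E, V)) :
    inner ℂ (toL2 (partialOp v f)) (toL2 g) = -inner ℂ (toL2 f) (toL2 (partialOp v g)) := by
  rw [inner_toL2, inner_toL2]
  have h := integral_bilinear_lineDerivOp_right_eq_neg_left (μ := volume) f g
    (isBoundedBilinearMap_inner (𝕜 := ℂ) (E := V)).toContinuousLinearMap v
  exact (neg_eq_iff_eq_neg.2 h).symm

theorem inner_coordOp_left (v : E) (f g : 𝓢(E, V)) :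
    inner ℂ (toL2 (coordOp v f)) (toL2 g) = inner ℂ (toL2 f) (toL2 (coordOp v g)) := by
  rw [inner_toL2, inner_toL2]
  refine integral_congr_ae (Filter.Eventually.of_forall fun y => ?_)
  simp only [coordOp_apply, inner_smul_left, inner_smul_right, Complex.conj_ofReal]

theorem inner_pointwiseOp_left {L L' : V →L[ℂ] V} (h : ∀ s t, inner ℂ (L s) t = inner ℂ s (L' t))
    (f g : 𝓢(E, V)) :
    inner ℂ (toL2 (pointwiseOp L f)) (toL2 g) = inner ℂ (toL2 f) (toL2 (pointwiseOp L' g)) := by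
  rw [inner_toL2, inner_toL2]
  refine integral_congr_ae (Filter.Eventually.of_forall fun y => ?_)
  simp only [pointwiseOp_apply, h]

/-- The vectors generated from Gaussians by the creation operators are total in `L²`. -/
theorem eq_zero_of_forall_inner_fockVec {n m : ℕ} {κ : ℂ} {c d : Fin n → Module.End ℂ 𝓢(E, V)}
    (b : OrthonormalBasis (Fin n) ℝ E) [CompleteSpace V]
    (h : OscillatorRel κ (fun j => annihilate (b j)) (fun j => create (b j)) c d)
    (s : OrthonormalBasis (Fin m) ℂ V) (f : Lp V 2 (volume : Measure E))
    (hf : ∀ k u, inner ℂ (toL2 (fockVec (fun j => create (b j)) (gaussian (s k)) u)) f = 0) :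
    f = 0 := by
  have hspan : ∀ k, ∀ φ ∈ Submodule.span ℂ (Set.range
      (fockVec (fun j => create (b j)) (gaussian (s k) : 𝓢(E, V)))),
      inner ℂ (toL2 φ) f = 0 := by
    intro k φ hφ
    induction hφ using Submodule.span_induction with
    | mem x hx => obtain ⟨u, rfl⟩ := hx; exact hf k u
    | zero =>
      have : toL2 (0 : 𝓢(E, V)) = 0 := map_zero (toLpCLM ℂ V 2 (volume : Measure E))
      rw [this, inner_zero_left]
    | add x y _ _ hx hy =>
      have : toL2 (x + y) = toL2 x + toL2 y := map_add (toLpCLM ℂ V 2 (volume : Measure E)) x y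
      rw [this, inner_add_left, hx, hy, add_zero]
    | smul a x _ hx =>
      have : toL2 (a • x) = a • toL2 x := map_smul (toLpCLM ℂ V 2 (volume : Measure E)) a x
      rw [this, inner_smul_left, hx, mul_zero]
  refine eq_zero_of_integral_gaussian f fun ξ k => ?_
  have hint : Integrable fun y => ((inner ℝ ξ y : ℝ) ^ k * Real.exp (-Real.pi * ‖y‖ ^ 2)) • f y := by
    -- The bound used is `|⟪ξ, y⟫|^k ≤ k! e^{‖ξ‖‖y‖}`.
    have h2 := (integrable_exp_smul f ‖ξ‖).smul (k.factorial : ℝ)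
    refine h2.mono (AEStronglyMeasurable.smul (𝕜 := ℝ) (by fun_prop) (Lp.aestronglyMeasurable f))
      (Filter.Eventually.of_forall fun y => ?_)
    simp only [Pi.smul_apply, norm_smul, norm_mul, norm_pow, Real.norm_of_nonneg (Real.exp_pos _).le,
      Real.norm_natCast]
    rw [mul_assoc, ← mul_assoc (k.factorial : ℝ)]
    gcongr
    have h3 := Real.pow_div_factorial_le_exp (‖ξ‖ * ‖y‖) (by positivity) k
    rw [div_le_iff₀ (by positivity), mul_comm (Real.exp _)] at h3
    refine le_trans ?_ h3
    gcongr
    exact norm_inner_le_norm ξ y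
  -- The vector-valued moment vanishes because each of its coordinates in the basis `s` is an inner
  -- product of `f` with a vector in the Fock span.
  refine s.repr.injective (PiLp.ext fun i => ?_)
  rw [s.repr_apply_apply, map_zero, PiLp.zero_apply, ← integral_inner hint,
    ← hspan i _ (coordOp_pow_gaussian_mem b h (s i) ξ k), L2.inner_def]
  refine integral_congr_ae ?_
  filter_upwards [coeFn_toLp ((coordOp ξ ^ k) (gaussian (s i)) : 𝓢(E, V)) 2 volume] with y hy
  rw [hy, coordOp_pow_apply, gaussian_apply, ← Complex.coe_smul, ← Complex.coe_smul, smul_smul,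
    inner_smul_left, inner_smul_right, map_mul, Complex.conj_ofReal, Complex.conj_ofReal,
    Complex.ofReal_mul]

end L2

end SchwartzOperators

/-! ### The Dirac operator on spinors and its spectrum -/

section SpinorOperators

open MeasureTheory SchwartzMap LineDeriv

universe u

theorem nonneg_of_inner_smul_self {V : Type*} [NormedAddCommGroup V] [InnerProductSpace ℂ V]
    {s : V} (hs : s ≠ 0) {μ r : ℝ} (hr : 0 ≤ r) (h : inner ℂ s ((μ : ℂ) • s) = (r : ℂ)) :
    0 ≤ μ := by
  rw [inner_smul_right, inner_self_eq_norm_sq_to_K] at h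
  have h2 : μ * ‖s‖ ^ 2 = r := by
    apply Complex.ofReal_injective
    rw [← h]
    push_cast
    rfl
  have h3 : 0 < ‖s‖ ^ 2 := by positivity
  exact nonneg_of_mul_nonneg_left (h2 ▸ hr) h3

section Symmetric

variable {E V : Type u} [NormedAddCommGroup E] [InnerProductSpace ℝ E] [FiniteDimensional ℝ E]
  [MeasurableSpace E] [BorelSpace E] [NormedAddCommGroup V] [InnerProductSpace ℂ V]

/-- The operator `L ∂_v - 2πi ⟪v, y⟫ L'` on Schwartz functions. -/
noncomputable def diracTerm (v : E) (L L' : V →L[ℂ] V) : Module.End ℂ 𝓢(E, V) :=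
  pointwiseOp L * partialOp v - (2 * Real.pi * Complex.I) • (coordOp v * pointwiseOp L')

/-- `L ∂_v` is a product of two commuting skew operators; in the other term the skewness of `L'` is
compensated by the factor `i`. -/
theorem inner_diracTerm_left (v : E) {L L' : V →L[ℂ] V}
    (hL : ∀ s t, inner ℂ (L s) t = -inner ℂ s (L t))
    (hL' : ∀ s t, inner ℂ (L' s) t = -inner ℂ s (L' t)) (f g : 𝓢(E, V)) :
    inner ℂ (toL2 (diracTerm v L L' f)) (toL2 g) = inner ℂ (toL2 f) (toL2 (diracTerm v L L' g)) := by
  let T := toLpCLM ℂ V 2 (volume : Measure E)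
  have hT : ∀ f : 𝓢(E, V), toL2 (diracTerm v L L' f) =
      toL2 (pointwiseOp L (partialOp v f)) -
        (2 * Real.pi * Complex.I) • toL2 (coordOp v (pointwiseOp L' f)) := fun f => by
    show T (pointwiseOp L (partialOp v f) -
      (2 * Real.pi * Complex.I : ℂ) • coordOp v (pointwiseOp L' f)) = _
    rw [map_sub, map_smul]
    rfl
  have hneg : ∀ (L : V →L[ℂ] V) (g : 𝓢(E, V)),
      toL2 (pointwiseOp (-L) g) = -toL2 (pointwiseOp L g) := fun L g =>
    map_neg T (pointwiseOp L g)
  have h1 := inner_pointwiseOp_left (E := E) (L := L) (L' := -L) fun s t => by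
    rw [hL, _root_.neg_apply, inner_neg_right]
  have h2 := inner_pointwiseOp_left (E := E) (L := L') (L' := -L') fun s t => by
    rw [hL', _root_.neg_apply, inner_neg_right]
  have hcomm1 : pointwiseOp L (partialOp v g) = partialOp v (pointwiseOp L g) :=
    (LinearMap.congr_fun (partialOp_mul_pointwiseOp v L) g).symm
  have hcomm2 : coordOp v (pointwiseOp L' g) = pointwiseOp L' (coordOp v g) :=
    LinearMap.congr_fun (coordOp_mul_pointwiseOp v L') g
  rw [hT, hT, inner_sub_left, inner_sub_right, inner_smul_left, inner_smul_right, hcomm1, hcomm2,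
    inner_coordOp_left, h1, h2, hneg, hneg, inner_neg_right, inner_neg_right,
    inner_partialOp_left, neg_neg]
  simp only [map_mul, Complex.conj_I, Complex.conj_ofReal, map_ofNat]
  ring

end Symmetric

variable {𝔱 : Type u} [NormedAddCommGroup 𝔱] [InnerProductSpace ℝ 𝔱] [FiniteDimensional ℝ 𝔱]
  {n : ℕ} (b : OrthonormalBasis (Fin n) ℝ 𝔱)

theorem cliffordMul_mul (x y : Cl 𝔱) :
    cliffordMul b (x * y) = cliffordMul b x ∘L cliffordMul b y :=
  ContinuousLinearMap.ext fun s => Subtype.ext (mul_assoc x y (s : Cl 𝔱))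

theorem inner_cliffordMul_left (x : Cl 𝔱) (s t : Spinor b) :
    inner ℂ (cliffordMul b x s) t = inner ℂ s (cliffordMul b (star x) t) := by
  rw [spinor_inner, spinor_inner, cliffordMul_apply, cliffordMul_apply, star_mul, mul_assoc]

/-- The pointwise action of the Clifford algebra on spinor-valued Schwartz functions. -/
noncomputable def cliffordOp : Cl 𝔱 →ₐ[ℂ] Module.End ℂ 𝓢(𝔱, Spinor b) :=
  AlgHom.ofLinearMap
    { toFun := fun x => pointwiseOp (cliffordMul b x)
      map_add' := fun x y => LinearMap.ext fun f => SchwartzMap.ext fun v =>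
        Subtype.ext (add_mul x y (f v : Cl 𝔱))
      map_smul' := fun a x => LinearMap.ext fun f => SchwartzMap.ext fun v =>
        Subtype.ext (smul_mul_assoc a x (f v : Cl 𝔱)) }
    (LinearMap.ext fun f => SchwartzMap.ext fun v => Subtype.ext (one_mul (f v : Cl 𝔱)))
    (fun x y => LinearMap.ext fun f => SchwartzMap.ext fun v =>
      Subtype.ext (mul_assoc x y (f v : Cl 𝔱)))

theorem cliffordOp_eq (x : Cl 𝔱) : cliffordOp b x = pointwiseOp (cliffordMul b x) := rfl

theorem oscillatorRel : OscillatorRel (4 * Real.pi : ℂ)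
    (fun j => (annihilate (b j) : Module.End ℂ 𝓢(𝔱, Spinor b))) (fun j => create (b j))
    (fun j => cliffordOp b (lower (genE b) (genF b) j))
    (fun j => cliffordOp b (raise (genE b) (genF b) j)) where
  aa i j := annihilate_comm _ _
  aa'' i j := create_comm _ _
  aa' i j := by
    rw [annihilate_mul_create, orthonormal_iff_ite.1 b.orthonormal]
    split_ifs <;> simp
  cc i j := by rw [← map_mul, ← map_mul, (cliffordRel b).lower_lower, map_neg]
  dd i j := by rw [← map_mul, ← map_mul, (cliffordRel b).raise_raise, map_neg]
  cd i j := by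
    rw [← map_mul, ← map_mul, (cliffordRel b).lower_raise, map_sub]
    split_ifs <;> simp
  ac i j := annihilate_mul_pointwiseOp _ _
  ad i j := annihilate_mul_pointwiseOp _ _
  a'c i j := create_mul_pointwiseOp _ _
  a'd i j := create_mul_pointwiseOp _ _

theorem schwartzOp_eq : schwartzOp b =
    ∑ j, (cliffordOp b (lower (genE b) (genF b) j) * annihilate (b j) +
      cliffordOp b (raise (genE b) (genF b) j) * create (b j)) := by
  have h : schwartzOp b = ∑ j, (cliffordOp b (genF b j) * partialOp (b j) -
      (2 * Real.pi * Complex.I) • (coordOp (b j) * cliffordOp b (genE b j))) := by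
    ext1 f
    rw [LinearMap.sum_apply]
    rfl
  rw [h]
  refine Finset.sum_congr rfl fun j _ => ?_
  rw [cliffordOp_eq b (genE b j), coordOp_mul_pointwiseOp, ← cliffordOp_eq]
  simp only [lower, raise, annihilate, create, map_smul, map_sub, map_add, mul_add, add_mul,
    sub_mul, mul_neg, smul_mul_assoc, mul_smul_comm]
  module

/-- The fermion number operator `∑ⱼ (1 - ½ (1 - i e_j ε^j))` on spinors. -/
noncomputable def fermionNumber : Cl 𝔱 := ∑ j, (1 - halfProj (genE b) (genF b) j)

theorem cliffordOp_fermionNumber : ∑ j, cliffordOp b (lower (genE b) (genF b) j) *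
    cliffordOp b (raise (genE b) (genF b) j) = cliffordOp b (fermionNumber b) := by
  rw [fermionNumber, map_sum]
  refine Finset.sum_congr rfl fun j _ => ?_
  rw [← map_mul, (cliffordRel b).lower_mul_raise_self]

theorem star_fermionNumber : star (fermionNumber b) = fermionNumber b := by
  simp [fermionNumber, (cliffordRel b).star_halfProj]

theorem isSymmetric_fermionNumber : (cliffordMul b (fermionNumber b)).toLinearMap.IsSymmetric := by
  intro s t
  have h := inner_cliffordMul_left b (fermionNumber b) s t
  rw [star_fermionNumber] at h
  exact h

/-- Each `1 - p_j` is a self-adjoint idempotent. The sum of squares gives both nonnegativity of the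
eigenvalues and the description of the kernel. -/
theorem inner_fermionNumber (s : Spinor b) : inner ℂ s (cliffordMul b (fermionNumber b) s) =
    ((∑ j, ‖cliffordMul b (1 - halfProj (genE b) (genF b) j) s‖ ^ 2 : ℝ) : ℂ) := by
  have e : cliffordMul b (fermionNumber b) s =
      ∑ j, cliffordMul b (1 - halfProj (genE b) (genF b) j) s := by
    refine Subtype.ext ?_
    rw [cliffordMul_apply, fermionNumber, Finset.sum_mul, AddSubmonoidClass.coe_finsetSum]
    rfl
  rw [e, inner_sum]
  push_cast
  refine Finset.sum_congr rfl fun j _ => ?_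
  have hp := (cliffordRel b).halfProj_mul_self j
  have h1 : (1 - halfProj (genE b) (genF b) j) * (1 - halfProj (genE b) (genF b) j) =
      1 - halfProj (genE b) (genF b) j := by
    rw [mul_sub, mul_one, sub_mul, one_mul, hp, sub_self, sub_zero]
  have h2 := inner_self_eq_norm_sq_to_K (𝕜 := ℂ)
    (cliffordMul b (1 - halfProj (genE b) (genF b) j) s)
  rw [inner_cliffordMul_left, star_sub, star_one, (cliffordRel b).star_halfProj,
    ← ContinuousLinearMap.comp_apply, ← cliffordMul_mul, h1] at h2
  exact h2

theorem fermionNumber_eigenvalue_nonneg {s : Spinor b} (hs : s ≠ 0) {μ : ℝ}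
    (h : cliffordMul b (fermionNumber b) s = (μ : ℂ) • s) : 0 ≤ μ := by
  refine nonneg_of_inner_smul_self hs (Finset.sum_nonneg (s := Finset.univ) fun j _ => sq_nonneg
    ‖cliffordMul b (1 - halfProj (genE b) (genF b) j) s‖) ?_
  rw [← h]
  exact inner_fermionNumber b s

/-- Every `(1 - p_j) s` vanishes, so `P s = s`; since also `s P = s`, the spinor lies in the corner
`P Cℓ P = ℂP`. -/
theorem mem_span_vacuum {s : Spinor b} (h : cliffordMul b (fermionNumber b) s = 0) :
    s ∈ Submodule.span ℂ {vacuum b} := by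
  have h1 := inner_fermionNumber b s
  rw [h, inner_zero_right, eq_comm, Complex.ofReal_eq_zero,
    Finset.sum_eq_zero_iff_of_nonneg fun _ _ => by positivity] at h1
  have h2 : ∀ j, halfProj (genE b) (genF b) j * (s : Cl 𝔱) = s := by
    intro j
    have h3 := congrArg Subtype.val (norm_eq_zero.1 (pow_eq_zero_iff two_ne_zero |>.1
      (h1 j (Finset.mem_univ j))))
    rw [cliffordMul_apply, sub_mul, one_mul] at h3
    exact (sub_eq_zero.1 h3).symm
  have h3 : proj b * (s : Cl 𝔱) = s := vacuumProj_mul_eq_self h2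
  refine Submodule.mem_span_singleton.2 ⟨corner b s, Subtype.ext ?_⟩
  show corner b s • proj b = s
  rw [← corner_spec, mul_assoc, s.mul_proj, h3]

theorem vacuum_ne_zero : vacuum b ≠ 0 := fun h => proj_ne_zero b (congrArg Subtype.val h)

/-- The annihilators kill the Gaussian and the `d_j` kill `P`, so both parts of each summand vanish.
-/
theorem schwartzOp_gaussian_vacuum : schwartzOp b (gaussian (vacuum b)) = 0 := by
  rw [schwartzOp_eq, LinearMap.sum_apply]
  refine Finset.sum_eq_zero fun j _ => ?_
  have h : cliffordOp b (raise (genE b) (genF b) j) (gaussian (vacuum b)) = 0 := by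
    ext1 y
    rw [cliffordOp_eq, pointwiseOp_apply, gaussian_apply, ← Complex.coe_smul, map_smul]
    have h1 : cliffordMul b (raise (genE b) (genF b) j) (vacuum b) = 0 :=
      Subtype.ext ((cliffordRel b).raise_mul_vacuum j)
    rw [h1, smul_zero]
    rfl
  rw [LinearMap.add_apply, Module.End.mul_apply, annihilate_gaussian, map_zero, zero_add,
    (oscillatorRel b).a'd j j |>.symm, Module.End.mul_apply, h, map_zero]

theorem gen_mul_gen_mul_mem_evenCl (m m' : 𝔱 × StrongDual ℝ 𝔱) {x : Cl 𝔱} (hx : x ∈ evenCl) :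
    (1 ⊗ₜ[ℝ] CliffordAlgebra.ι (form 𝔱) m) * (1 ⊗ₜ[ℝ] CliffordAlgebra.ι (form 𝔱) m') * x ∈
      (evenCl : Submodule ℂ (Cl 𝔱)) := by
  rw [evenCl, Submodule.baseChange_eq_span] at hx ⊢
  induction hx using Submodule.span_induction with
  | mem x hx =>
    obtain ⟨y, hy, rfl⟩ := hx
    refine Submodule.subset_span
      ⟨CliffordAlgebra.ι (form 𝔱) m * CliffordAlgebra.ι (form 𝔱) m' * y, ?_, ?_⟩
    · have h := CliffordAlgebra.evenOdd_mul_le (form 𝔱) 0 0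
      exact h (Submodule.mul_mem_mul (CliffordAlgebra.ι_mul_ι_mem_evenOdd_zero _ m m') hy)
    · simp
  | zero => rw [mul_zero]; exact zero_mem _
  | add x y _ _ hx hy => rw [mul_add]; exact add_mem hx hy
  | smul c x _ hx => rw [mul_smul_comm]; exact Submodule.smul_mem _ _ hx

/-- Each factor of `P` is a combination of `1` and a product of two generators, so left
multiplication by it preserves the even part. -/
theorem proj_mem_evenCl : proj b ∈ (evenCl : Submodule ℂ (Cl 𝔱)) := by
  have key : ∀ l : List (Fin n), partProj (genE b) (genF b) l ∈ (evenCl : Submodule ℂ (Cl 𝔱)) := by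
    intro l
    induction l with
    | nil =>
      have h : (1 : Cl 𝔱) = (1 : ℂ) ⊗ₜ[ℝ] (1 : CliffordAlgebra (form 𝔱)) := rfl
      rw [partProj, List.map_nil, List.prod_nil, h]
      exact Submodule.tmul_mem_baseChange_of_mem _
        (Submodule.one_le.1 (CliffordAlgebra.one_le_evenOdd_zero _))
    | cons j l ih =>
      have : partProj (genE b) (genF b) (j :: l) =
          halfProj (genE b) (genF b) j * partProj (genE b) (genF b) l := by simp [partProj]
      rw [this, halfProj, smul_mul_assoc, sub_mul, one_mul, smul_mul_assoc]
      exact Submodule.smul_mem _ _ (sub_mem ih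
        (Submodule.smul_mem _ _ (gen_mul_gen_mul_mem_evenCl _ _ ih)))
  rw [proj, vacuumProj_eq]
  exact key _

section L2

variable [MeasurableSpace 𝔱] [BorelSpace 𝔱]

theorem inner_schwartzOp_left (f g : 𝓢(𝔱, Spinor b)) :
    inner ℂ (toL2 (schwartzOp b f)) (toL2 g) = inner ℂ (toL2 f) (toL2 (schwartzOp b g)) := by
  have h : ∀ f : 𝓢(𝔱, Spinor b), toL2 (schwartzOp b f) =
      ∑ j, toL2 (diracTerm (b j) (cliffordMul b (genF b j)) (cliffordMul b (genE b j)) f) := fun f =>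
    map_sum (toLpCLM ℂ (Spinor b) 2 (volume : Measure 𝔱)) _ _
  have hneg : ∀ x : Cl 𝔱, star x = -x → ∀ s t : Spinor b,
      inner ℂ (cliffordMul b x s) t = -inner ℂ s (cliffordMul b x t) := by
    intro x hx s t
    have h1 : cliffordMul b (-x) t = -cliffordMul b x t := Subtype.ext (neg_mul x (t : Cl 𝔱))
    rw [inner_cliffordMul_left, hx, h1, inner_neg_right]
  rw [h, h, sum_inner, inner_sum]
  exact Finset.sum_congr rfl fun j _ => inner_diracTerm_left (b j)
    (hneg _ ((cliffordRel b).star_F j)) (hneg _ ((cliffordRel b).star_E j)) f g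

theorem mem_graph_Q0Schwartz (f : 𝓢(𝔱, Spinor b)) :
    (toL2 f, toL2 (schwartzOp b f)) ∈ (Q0Schwartz b).graph := by
  rw [LinearPMap.mem_graph_iff]
  refine ⟨⟨toL2 f, f, rfl⟩, rfl, ?_⟩
  have h : (LinearEquiv.ofInjective (toLpCLM ℂ (Spinor b) 2 (volume : Measure 𝔱)).toLinearMap
      (injective_toLp 2 (volume : Measure 𝔱))).symm ⟨toL2 f, f, rfl⟩ = f :=
    LinearEquiv.symm_apply_apply (LinearEquiv.ofInjective _ _) f
  exact congrArg (fun g => toL2 (schwartzOp b g)) h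

theorem symmGraph_Q0Schwartz : SymmGraph (Q0Schwartz b).graph := by
  have h : ∀ p ∈ (Q0Schwartz b).graph, ∃ f, p = (toL2 f, toL2 (schwartzOp b f)) := by
    rintro ⟨x, x'⟩ hp
    obtain ⟨f, rfl⟩ : ∃ f : 𝓢(𝔱, Spinor b), toL2 f = x :=
      LinearPMap.mem_domain_of_mem_graph hp
    exact ⟨f, Prod.ext rfl ((Q0Schwartz b).mem_graph_snd_inj hp (mem_graph_Q0Schwartz b f) rfl)⟩
  intro p hp q hq
  obtain ⟨f, rfl⟩ := h p hp
  obtain ⟨g, rfl⟩ := h q hq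
  exact inner_schwartzOp_left b f g

theorem coeFn_smul_toL2_gaussian (c : ℂ) (s : Spinor b) :
    ⇑(c • toL2 (gaussian s : 𝓢(𝔱, Spinor b))) =ᵐ[volume] fun y : 𝔱 =>
      (c * (Real.exp (-Real.pi * ‖y‖ ^ 2) : ℝ)) • s := by
  filter_upwards [Lp.coeFn_smul c (toL2 (gaussian s : 𝓢(𝔱, Spinor b))),
    coeFn_toLp (gaussian s : 𝓢(𝔱, Spinor b)) 2 volume] with y h1 h2
  rw [h1, Pi.smul_apply, h2, gaussian_apply, ← Complex.coe_smul, smul_smul]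

theorem Q0_spectral : IsSelfAdjoint (Q0 b) ∧ HasCompactResolvent (Q0 b) ∧
    kernel (Q0 b) = Submodule.span ℂ {toL2 (gaussian (vacuum b) : 𝓢(𝔱, Spinor b))} := by
  have hsym := isSymmetric_fermionNumber b
  let s := hsym.eigenvectorBasis rfl
  let μ := hsym.eigenvalues rfl
  have hs : ∀ k, cliffordMul b (fermionNumber b) (s k) = (μ k : ℂ) • s k :=
    hsym.apply_eigenvectorBasis rfl
  have hs0 : ∀ k, s k ≠ 0 := fun k => s.orthonormal.ne_zero k
  have hμ : ∀ k, 0 ≤ μ k := fun k => fermionNumber_eigenvalue_nonneg b (hs0 k) (hs k)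
  -- Words that differ by a permutation give the same vector. The redundancy is harmless: only
  -- totality and finiteness of the index sets are needed.
  let ψ : List (Fin n) × Fin (Module.finrank ℂ (Spinor b)) → 𝓢(𝔱, Spinor b) :=
    fun i => fockVec (fun j => create (b j)) (gaussian (s i.2)) i.1
  let lam : List (Fin n) × Fin (Module.finrank ℂ (Spinor b)) → ℝ :=
    fun i => 4 * Real.pi * (i.1.length + μ i.2)
  have hpi : 0 < 4 * Real.pi := by positivity
  have hsq : ∀ i, schwartzOp b (schwartzOp b (ψ i)) = (lam i : ℂ) • ψ i := by
    intro i
    have h1 : (∑ j, cliffordOp b (lower (genE b) (genF b) j) *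
        cliffordOp b (raise (genE b) (genF b) j)) (gaussian (s i.2)) =
        (μ i.2 : ℂ) • gaussian (s i.2) := by
      rw [cliffordOp_fermionNumber]
      ext1 y
      rw [cliffordOp_eq, pointwiseOp_apply, _root_.smul_apply, gaussian_apply,
        ← Complex.coe_smul, map_smul, hs, smul_comm]
    have h2 := (oscillatorRel b).sq_fockVec (fun j => annihilate_gaussian (b j) (s i.2)) h1 i.1
    rw [← schwartzOp_eq] at h2
    rw [h2]
    simp only [lam]
    push_cast
    rfl
  obtain ⟨h1, h2, h3⟩ := (symmGraph_Q0Schwartz b).closure_of_eigenvectors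
    (fun i => toL2 (ψ i)) (fun i => toL2 (schwartzOp b (ψ i))) lam
    (fun i => mul_nonneg hpi.le (add_nonneg (Nat.cast_nonneg _) (hμ i.2)))
    (fun i => mem_graph_Q0Schwartz b (ψ i))
    (fun i => by
      have h := mem_graph_Q0Schwartz b (schwartzOp b (ψ i))
      rw [hsq] at h
      exact h)
    (fun f hf => eq_zero_of_forall_inner_fockVec b (oscillatorRel b) s f fun k u => hf (u, k))
    (fun C => by
      obtain ⟨N, hN⟩ := exists_nat_ge (C / (4 * Real.pi))
      refine ((List.finite_length_le (Fin n) N).prod Set.finite_univ).subset fun i hi => ⟨?_, trivial⟩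
      have hi' : 4 * Real.pi * (i.1.length + μ i.2) ≤ C := hi
      rw [div_le_iff₀ hpi] at hN
      have h5 : 4 * Real.pi * (i.1.length + μ i.2) ≤ 4 * Real.pi * N := by linarith
      have h6 := le_of_mul_le_mul_left h5 hpi
      have h7 : (i.1.length : ℝ) ≤ N := by linarith [hμ i.2]
      exact_mod_cast h7)
  refine ⟨h1, h2, h3.trans (le_antisymm (Submodule.span_le.2 ?_) ?_)⟩
  · rintro _ ⟨i, hi, rfl⟩
    have hi' : (i.1.length : ℝ) + μ i.2 = 0 := (mul_eq_zero.1 hi).resolve_left hpi.ne'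
    have hl : (0 : ℝ) ≤ i.1.length := Nat.cast_nonneg _
    have h4 : i.1 = [] := by
      have : (i.1.length : ℝ) = 0 := by linarith [hμ i.2]
      exact List.length_eq_zero_iff.1 (by exact_mod_cast this)
    have h5 : μ i.2 = 0 := by linarith [hμ i.2]
    have h6 := hs i.2
    rw [h5, Complex.ofReal_zero, zero_smul] at h6
    obtain ⟨c, hc⟩ := Submodule.mem_span_singleton.1 (mem_span_vacuum b h6)
    refine Submodule.mem_span_singleton.2 ⟨c, ?_⟩
    have h7 : ψ i = c • gaussian (vacuum b) := by
      simp only [ψ]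
      rw [h4, fockVec_nil, ← hc]
      ext1 y
      rw [_root_.smul_apply, gaussian_apply, gaussian_apply, smul_comm]
    simp only [h7]
    exact (map_smul (toLpCLM ℂ (Spinor b) 2 (volume : Measure 𝔱)) c _).symm
  -- The chosen eigenbasis need not contain the vacuum spinor itself, so its Gaussian is put in the
  -- kernel directly, as a Schwartz function killed by the operator.
  · rw [← h3, Submodule.span_singleton_le_iff_mem]
    have h4 := mem_graph_Q0Schwartz b (gaussian (vacuum b))
    rw [schwartzOp_gaussian_vacuum] at h4
    have h5 := LinearPMap.le_graph_of_le (Q0Schwartz b).le_closure h4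
    obtain ⟨y, hy, hy'⟩ := (LinearPMap.mem_graph_iff _).1 h5
    refine Submodule.mem_map.2 ⟨y, ?_, hy⟩
    exact LinearMap.mem_ker.2 (hy'.trans (map_zero (toLpCLM ℂ (Spinor b) 2 (volume : Measure 𝔱))))

theorem toL2_gaussian_vacuum_ne_zero : toL2 (gaussian (vacuum b) : 𝓢(𝔱, Spinor b)) ≠ 0 := by
  intro h
  have h1 : (gaussian (vacuum b) : 𝓢(𝔱, Spinor b)) = 0 :=
    injective_toLp 2 (volume : Measure 𝔱)
      (h.trans (map_zero (toLpCLM ℂ (Spinor b) 2 (volume : Measure 𝔱))).symm)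
  have h2 := congrArg (fun f : 𝓢(𝔱, Spinor b) => f 0) h1
  exact vacuum_ne_zero b ((smul_eq_zero.1 h2).resolve_left (Real.exp_pos _).ne')

end L2

end SpinorOperators

end Ladder

theorem mainTheorem11 {𝔱 : Type*} [NormedAddCommGroup 𝔱] [InnerProductSpace ℝ 𝔱]
    [FiniteDimensional ℝ 𝔱] [MeasurableSpace 𝔱] [BorelSpace 𝔱] {n : ℕ}
    (b : OrthonormalBasis (Fin n) ℝ 𝔱) :
    IsSelfAdjoint (Ladder.Q0 b) ∧
    Ladder.HasCompactResolvent (Ladder.Q0 b) ∧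
    Module.finrank ℂ (Ladder.kernel (Ladder.Q0 b)) = 1 ∧
    (∀ f : Ladder.L2Spinor b, f ∈ Ladder.kernel (Ladder.Q0 b) ↔
      ∃ c : ℂ, f =ᵐ[MeasureTheory.volume] fun y : 𝔱 =>
        (c * (Real.exp (-Real.pi * ‖y‖ ^ 2) : ℝ)) • Ladder.vacuum b) ∧
    Ladder.kernel (Ladder.Q0 b) ≤ Ladder.evenL2 b := by
  obtain ⟨h1, h2, h3⟩ := Ladder.Q0_spectral b
  have hmem : ∀ f : Ladder.L2Spinor b, f ∈ Ladder.kernel (Ladder.Q0 b) ↔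
      ∃ c : ℂ, f =ᵐ[MeasureTheory.volume] fun y : 𝔱 =>
        (c * (Real.exp (-Real.pi * ‖y‖ ^ 2) : ℝ)) • Ladder.vacuum b := by
    intro f
    rw [h3, Submodule.mem_span_singleton]
    refine exists_congr fun c => ⟨?_, fun h => ?_⟩
    · rintro rfl
      exact Ladder.coeFn_smul_toL2_gaussian b c _
    · exact MeasureTheory.Lp.ext ((Ladder.coeFn_smul_toL2_gaussian b c _).trans h.symm)
  refine ⟨h1, h2, ?_, hmem, fun f hf => ?_⟩
  · rw [h3]
    exact finrank_span_singleton (Ladder.toL2_gaussian_vacuum_ne_zero b)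
  · obtain ⟨c, hc⟩ := (hmem f).1 hf
    filter_upwards [hc] with y hy
    rw [hy]
    -- Kernel elements take values in `ℂP` almost everywhere, so evenness of `P` suffices.
    exact Submodule.smul_mem _ _ (Ladder.proj_mem_evenCl b)
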